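/- For $1\le p<\infty$ let $\mathcal H^p$ be the completion of the space of Dirichlet polynomials $P(s)=\sum_{n\le N}a_n n^{-s}$ with respect to the norm $$\|P\|_{\mathcal H^p}=\Big(\lim_{T\to\infty}\frac1T\int_0^T|P(it)|^p\,dt\Big)^{1/p}.$$ The coefficient functionals $P\mapsto a_n$ extend continuously to $\mathcal H^p$, and every $f\in\mathcal H^p$ is identified with its Dirichlet series $f(s)=\sum_{n\ge1}a_n n^{-s}$, $\operatorname{Re}s>1/2$. Let $\mathcal H^p_0$ be the subspace of those $f\in\mathcal H^p$ with $a_1=0$, that is, of the series $\sum_{n\ge2}a_n n^{-s}$, which vanish at $+\infty$. Let $$\mathbf Hf(s)=\int_{1/2}^{+\infty}f(w)\,(\zeta(w+s)-1)\,dw,\qquad \operatorname{Re}s>1/2,$$ where $\zeta$ is the Riemann zeta function; the integral converges absolutely for every Dirichlet polynomial $f\in\mathcal H^p_0$. **Theorem.** If $1\le p<\infty$ and $p\ne2$, then $\mathbf H$ does not act boundedly on $\mathcal H^p_0$: there is no bounded linear operator $T:\mathcal H^p_0\to\mathcal H^p_0$ such that $(Tf)(s)=\mathbf Hf(s)$ for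 all Dirichlet polynomials $f\in\mathcal H^p_0$ and all $s$ with $\operatorname{Re}s>1/2$. -/

import Mathlib

open Filter MeasureTheory Topology

noncomputable section

/-! ### Dirichlet polynomials and mean values along the imaginary axis -/

/-- The Dirichlet polynomial `∑ aₙ n^{-s}` with finitely many nonzero coefficients `aₙ`, `n ≥ 1`. -/
def dirEval (a : ℕ+ →₀ ℂ) (s : ℂ) : ℂ := a.sum fun n c => c * ((n : ℕ) : ℂ) ^ (-s)

/-- The mean of `|P(it)|^p` over `0 ≤ t ≤ T`. -/
def dirMean (p : ℝ) (a : ℕ+ →₀ ℂ) (T : ℝ) : ℝ :=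
  (1 / T) * ∫ t in (0 : ℝ)..T, ‖dirEval a ((t : ℂ) * Complex.I)‖ ^ p

/-- `‖P‖ = (lim_{T → ∞} (1/T) ∫_0^T |P(it)|^p dt)^{1/p}`; the limit exists by
`tendsto_dirMean` below. -/
def dirNorm (p : ℝ) (a : ℕ+ →₀ ℂ) : ℝ := (limUnder atTop (dirMean p a)) ^ (1 / p)

lemma dirEval_add (a b : ℕ+ →₀ ℂ) (s : ℂ) : dirEval (a + b) s = dirEval a s + dirEval b s := by
  unfold dirEval
  exact Finsupp.sum_add_index' (by simp) (by intros; ring)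

lemma dirEval_smul (c : ℂ) (a : ℕ+ →₀ ℂ) (s : ℂ) : dirEval (c • a) s = c * dirEval a s := by
  unfold dirEval
  rw [Finsupp.sum_smul_index' (by simp), Finsupp.sum, Finsupp.sum, Finset.mul_sum]
  exact Finset.sum_congr rfl fun n _ => by simp [mul_assoc]

/-- The exponential `t ↦ e^{iλt}`. -/
def meanExp (l : ℝ) (t : ℝ) : ℂ := Complex.exp ((l : ℂ) * (t : ℂ) * Complex.I)

/-- Trigonometric polynomials with arbitrary real frequencies. -/
def trigAlg : Subalgebra ℂ (ℝ → ℂ) := Algebra.adjoin ℂ (Set.range meanExp)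

lemma continuous_meanExp (l : ℝ) : Continuous (meanExp l) := by
  unfold meanExp; fun_prop

lemma trigAlg_eq_span : Subalgebra.toSubmodule trigAlg = Submodule.span ℂ (Set.range meanExp) := by
  unfold trigAlg
  rw [Algebra.adjoin_eq_span]
  let S : Submonoid (ℝ → ℂ) :=
    { carrier := Set.range meanExp
      one_mem' := ⟨0, by ext t; simp [meanExp]⟩
      mul_mem' := by
        rintro _ _ ⟨l, rfl⟩ ⟨m, rfl⟩
        refine ⟨l + m, ?_⟩
        ext t
        simp only [meanExp, Pi.mul_apply, ← Complex.exp_add]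
        congr 1
        push_cast
        ring }
  have : Submonoid.closure (Set.range meanExp) = S := Submonoid.closure_eq S
  rw [this]
  rfl

lemma dirEval_mem_trigAlg (a : ℕ+ →₀ ℂ) :
    (fun t : ℝ => dirEval a ((t : ℂ) * Complex.I)) ∈ trigAlg := by
  have h : (fun t : ℝ => dirEval a ((t : ℂ) * Complex.I))
      = ∑ n ∈ a.support, a n • meanExp (-Real.log (n : ℕ)) := by
    ext t
    simp only [dirEval, Finsupp.sum, Finset.sum_apply, Pi.smul_apply, smul_eq_mul, meanExp]
    refine Finset.sum_congr rfl fun n _ => ?_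
    have hn : (((n : ℕ) : ℂ)) ≠ 0 := by simp
    rw [Complex.cpow_def_of_ne_zero hn, Complex.natCast_log.symm]
    congr 2
    push_cast
    ring
  rw [h]
  exact sum_mem fun n _ => Subalgebra.smul_mem trigAlg
    (Algebra.subset_adjoin (Set.mem_range_self (-Real.log (n : ℕ)))) (a n)

lemma conj_mem_trigAlg {f : ℝ → ℂ} (hf : f ∈ trigAlg) :
    (fun t => (starRingEnd ℂ) (f t)) ∈ trigAlg := by
  unfold trigAlg at hf
  induction hf using Algebra.adjoin_induction with
  | mem x hx =>
    obtain ⟨l, rfl⟩ := hx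
    refine Algebra.subset_adjoin ⟨-l, ?_⟩
    ext t
    simp [meanExp, ← Complex.exp_conj]
  | algebraMap r => exact Subalgebra.algebraMap_mem trigAlg ((starRingEnd ℂ) r)
  | add x y _ _ hx hy =>
    have h := add_mem hx hy
    convert h using 1
    ext t
    simp
  | mul x y _ _ hx hy =>
    have h := mul_mem hx hy
    convert h using 1
    ext t
    simp

lemma tendsto_mean_meanExp (l : ℝ) :
    Tendsto (fun T : ℝ => ((1 / T : ℝ) : ℂ) * ∫ t in (0 : ℝ)..T, meanExp l t) atTop
      (𝓝 (if l = 0 then 1 else 0)) := by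
  by_cases hl : l = 0
  · subst hl
    refine (tendsto_const_nhds (x := (1 : ℂ))).congr' ?_ |>.trans (by simp)
    filter_upwards [eventually_gt_atTop 0] with T hT
    have : (T : ℂ) ≠ 0 := by exact_mod_cast hT.ne'
    simp [meanExp, this]
  · simp only [hl, if_false]
    have hc : ((l : ℂ) * Complex.I) ≠ 0 := by simp [hl]
    have hI : ∀ T : ℝ, ∫ t in (0 : ℝ)..T, meanExp l t
        = (Complex.exp ((l : ℂ) * Complex.I * T) - 1) / ((l : ℂ) * Complex.I) := by
      intro T
      have := integral_exp_mul_complex (a := 0) (b := T) hc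
      simp only [Complex.ofReal_zero, mul_zero, Complex.exp_zero] at this
      rw [← this]
      congr 1
      ext t
      simp only [meanExp]
      congr 1
      ring
    rw [tendsto_zero_iff_norm_tendsto_zero]
    have hlim : Tendsto (fun T : ℝ => (1 / T) * (2 / |l|)) atTop (𝓝 0) := by
      simpa using (tendsto_inv_atTop_zero (𝕜 := ℝ)).mul_const (2 / |l|)
    refine squeeze_zero' (Eventually.of_forall fun _ => norm_nonneg _) ?_ hlim
    filter_upwards [eventually_gt_atTop 0] with T hT
    rw [hI, norm_mul, Complex.norm_real, Real.norm_of_nonneg (by positivity), norm_div]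
    gcongr
    · calc ‖Complex.exp ((l : ℂ) * Complex.I * T) - 1‖
          ≤ ‖Complex.exp ((l : ℂ) * Complex.I * T)‖ + ‖(1 : ℂ)‖ := norm_sub_le _ _
        _ = 2 := by
          have : (l : ℂ) * Complex.I * T = ((l * T : ℝ) : ℂ) * Complex.I := by push_cast; ring
          rw [this, Complex.norm_exp_ofReal_mul_I]
          norm_num
    · simp

lemma trigAlg_mean {f : ℝ → ℂ} (hf : f ∈ trigAlg) :
    (Continuous f ∧ ∃ B, ∀ t, ‖f t‖ ≤ B) ∧
      ∃ c, Tendsto (fun T : ℝ => ((1 / T : ℝ) : ℂ) * ∫ t in (0 : ℝ)..T, f t) atTop (𝓝 c) := by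
  rw [← Subalgebra.mem_toSubmodule, trigAlg_eq_span] at hf
  induction hf using Submodule.span_induction with
  | mem x hx =>
    obtain ⟨l, rfl⟩ := hx
    refine ⟨⟨continuous_meanExp l, 1, fun t => ?_⟩, _, tendsto_mean_meanExp l⟩
    have : (l : ℂ) * t * Complex.I = ((l * t : ℝ) : ℂ) * Complex.I := by push_cast; ring
    rw [meanExp, this, Complex.norm_exp_ofReal_mul_I]
  | zero => exact ⟨⟨continuous_zero, 0, by simp⟩, 0, by simp⟩
  | add x y _ _ hx hy =>
    obtain ⟨⟨hxc, B, hB⟩, c, hc⟩ := hx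
    obtain ⟨⟨hyc, B', hB'⟩, c', hc'⟩ := hy
    refine ⟨⟨hxc.add hyc, B + B', fun t => (norm_add_le _ _).trans (add_le_add (hB t) (hB' t))⟩,
      c + c', ?_⟩
    refine (hc.add hc').congr fun T => ?_
    simp only [Pi.add_apply]
    rw [intervalIntegral.integral_add (hxc.intervalIntegrable _ _) (hyc.intervalIntegrable _ _)]
    ring
  | smul r x _ hx =>
    obtain ⟨⟨hxc, B, hB⟩, c, hc⟩ := hx
    refine ⟨⟨hxc.const_smul r, ‖r‖ * B, fun t => ?_⟩, r * c, ?_⟩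
    · simp only [Pi.smul_apply, smul_eq_mul, norm_mul]
      exact mul_le_mul_of_nonneg_left (hB t) (norm_nonneg _)
    · refine (hc.const_mul r).congr fun T => ?_
      simp only [Pi.smul_apply, smul_eq_mul]
      rw [intervalIntegral.integral_const_mul]
      ring

lemma continuous_dirEval_I (a : ℕ+ →₀ ℂ) :
    Continuous fun t : ℝ => dirEval a ((t : ℂ) * Complex.I) :=
  (trigAlg_mean (dirEval_mem_trigAlg a)).1.1

/-- Means of real functions that are uniform limits of trigonometric polynomials exist. -/
lemma exists_mean_of_approx (g : ℝ → ℝ) (hg : Continuous g)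
    (happ : ∀ ε > 0, ∃ f ∈ trigAlg, ∀ t, ‖(g t : ℂ) - f t‖ ≤ ε) :
    ∃ c : ℝ, Tendsto (fun T : ℝ => (1 / T) * ∫ t in (0 : ℝ)..T, g t) atTop (𝓝 c) := by
  refine CompleteSpace.complete (Metric.cauchy_iff.2 ⟨inferInstance, fun ε hε => ?_⟩)
  obtain ⟨f, hf, hfg⟩ := happ (ε / 6) (by positivity)
  obtain ⟨⟨hfc, -⟩, c, hc⟩ := trigAlg_mean hf
  have hev := (Metric.tendsto_nhds.1 hc) (ε / 6) (by positivity)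
  have hev' : ∀ᶠ T : ℝ in atTop,
      ‖(((1 / T) * ∫ t in (0 : ℝ)..T, g t : ℝ) : ℂ) - c‖ < ε / 2 := by
    filter_upwards [hev, eventually_gt_atTop 0] with T hT hT0
    have h1 : (((1 / T) * ∫ t in (0 : ℝ)..T, g t : ℝ) : ℂ)
        - ((1 / T : ℝ) : ℂ) * ∫ t in (0 : ℝ)..T, f t
        = ((1 / T : ℝ) : ℂ) * ∫ t in (0 : ℝ)..T, ((g t : ℂ) - f t) := by
      have hgc : Continuous fun t => (g t : ℂ) := Complex.continuous_ofReal.comp hg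
      rw [intervalIntegral.integral_sub (hgc.intervalIntegrable _ _)
        (hfc.intervalIntegrable _ _), intervalIntegral.integral_ofReal]
      push_cast
      ring
    have h2 : ‖∫ t in (0 : ℝ)..T, ((g t : ℂ) - f t)‖ ≤ ε / 6 * |T - 0| :=
      intervalIntegral.norm_integral_le_of_norm_le_const fun t _ => hfg t
    have h3 : ‖(((1 / T) * ∫ t in (0 : ℝ)..T, g t : ℝ) : ℂ)
        - ((1 / T : ℝ) : ℂ) * ∫ t in (0 : ℝ)..T, f t‖ ≤ ε / 6 := by
      rw [h1, norm_mul, Complex.norm_real, Real.norm_of_nonneg (by positivity)]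
      rw [sub_zero, abs_of_pos hT0] at h2
      calc 1 / T * _ ≤ 1 / T * (ε / 6 * T) := by gcongr
        _ = ε / 6 := by field_simp
    rw [dist_eq_norm] at hT
    calc _ = ‖((((1 / T) * ∫ t in (0 : ℝ)..T, g t : ℝ) : ℂ)
        - ((1 / T : ℝ) : ℂ) * ∫ t in (0 : ℝ)..T, f t)
        + (((1 / T : ℝ) : ℂ) * (∫ t in (0 : ℝ)..T, f t) - c)‖ := by congr 1; ring
      _ ≤ _ := norm_add_le _ _
      _ < ε / 2 := by linarith
  refine ⟨{x : ℝ | ‖(x : ℂ) - c‖ < ε / 2}, hev', fun x hx y hy => ?_⟩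
  simp only [Set.mem_ofPred_eq] at hx hy
  rw [Real.dist_eq, ← Real.norm_eq_abs, ← Complex.norm_real, Complex.ofReal_sub]
  calc ‖(x : ℂ) - y‖ = ‖((x : ℂ) - c) - ((y : ℂ) - c)‖ := by congr 1; ring
    _ ≤ ‖(x : ℂ) - c‖ + ‖(y : ℂ) - c‖ := norm_sub_le _ _
    _ < ε := by linarith

lemma exists_tendsto_dirMean (p : ℝ) (hp : 0 ≤ p) (a : ℕ+ →₀ ℂ) :
    ∃ c : ℝ, Tendsto (dirMean p a) atTop (𝓝 c) := by
  set F : ℝ → ℂ := fun t => dirEval a ((t : ℂ) * Complex.I) with hF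
  have hFm : F ∈ trigAlg := dirEval_mem_trigAlg a
  obtain ⟨⟨hFc, B, hB⟩, -⟩ := trigAlg_mean hFm
  refine exists_mean_of_approx (fun t => ‖F t‖ ^ p) (hFc.norm.rpow_const fun _ => Or.inr hp) ?_
  intro ε hε
  obtain ⟨q, hq⟩ := exists_polynomial_near_of_continuousOn 0 (B ^ 2) (fun x => x ^ (p / 2))
    (Real.continuous_rpow_const (by positivity)).continuousOn ε hε
  let G : ℝ → ℂ := F * fun t => (starRingEnd ℂ) (F t)
  have hG : G ∈ trigAlg := mul_mem hFm (conj_mem_trigAlg hFm)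
  refine ⟨Polynomial.aeval G (q.map (algebraMap ℝ ℂ)), ?_, fun t => ?_⟩
  · rw [Polynomial.aeval_eq_sum_range]
    exact sum_mem fun i _ => Subalgebra.smul_mem trigAlg (pow_mem hG i) _
  have h1 : (Polynomial.aeval G (q.map (algebraMap ℝ ℂ))) t = ((q.eval (‖F t‖ ^ 2) : ℝ) : ℂ) := by
    have hGt : G t = ((‖F t‖ ^ 2 : ℝ) : ℂ) := by
      simp [G, Complex.mul_conj, Complex.normSq_eq_norm_sq]
    have := Polynomial.aeval_algHom_apply (Pi.evalAlgHom ℂ (fun _ : ℝ => ℂ) t) G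
      (q.map (algebraMap ℝ ℂ))
    simp only [Pi.evalAlgHom_apply] at this
    rw [← this, hGt, Polynomial.aeval_map_algebraMap]
    exact Polynomial.aeval_algebraMap_apply ℂ (‖F t‖ ^ 2) q
  have h2 := hq (‖F t‖ ^ 2) ⟨by positivity, pow_le_pow_left₀ (norm_nonneg _) (hB t) 2⟩
  have h3 : (‖F t‖ ^ 2) ^ (p / 2) = ‖F t‖ ^ p := by
    rw [← Real.rpow_natCast, ← Real.rpow_mul (norm_nonneg _)]
    congr 1
    push_cast
    ring
  rw [h1, ← Complex.ofReal_sub, Complex.norm_real, Real.norm_eq_abs, abs_sub_comm]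
  rw [h3] at h2
  exact h2.le

lemma tendsto_dirMean (p : ℝ) (hp : 0 ≤ p) (a : ℕ+ →₀ ℂ) :
    Tendsto (dirMean p a) atTop (𝓝 (limUnder atTop (dirMean p a))) :=
  tendsto_nhds_limUnder (exists_tendsto_dirMean p hp a)

lemma dirMean_nonneg (p : ℝ) (a : ℕ+ →₀ ℂ) {T : ℝ} (hT : 0 < T) : 0 ≤ dirMean p a T :=
  mul_nonneg (by positivity)
    (intervalIntegral.integral_nonneg hT.le fun _ _ => by positivity)

lemma tendsto_dirMean_rpow (p : ℝ) (hp : 0 ≤ p) (a : ℕ+ →₀ ℂ) :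
    Tendsto (fun T => dirMean p a T ^ (1 / p)) atTop (𝓝 (dirNorm p a)) :=
  (tendsto_dirMean p hp a).rpow_const (Or.inr (by positivity))

/-- Normalized Lebesgue measure on `(0, T]`. -/
def meanMeasure (T : ℝ) : Measure ℝ := ENNReal.ofReal (1 / T) • volume.restrict (Set.Ioc 0 T)

lemma isProb_meanMeasure {T : ℝ} (hT : 0 < T) : IsProbabilityMeasure (meanMeasure T) := by
  refine ⟨?_⟩
  simp only [meanMeasure, Measure.smul_apply, Measure.restrict_apply MeasurableSet.univ,
    Set.univ_inter, Real.volume_Ioc, smul_eq_mul, sub_zero]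
  rw [← ENNReal.ofReal_mul (by positivity), one_div, inv_mul_cancel₀ hT.ne', ENNReal.ofReal_one]

lemma eLpNorm_meanMeasure (p : ℝ) (hp : 1 ≤ p) (a : ℕ+ →₀ ℂ) {T : ℝ} (hT : 0 < T) :
    MemLp (fun t : ℝ => dirEval a ((t : ℂ) * Complex.I)) (ENNReal.ofReal p) (meanMeasure T) ∧
    eLpNorm (fun t : ℝ => dirEval a ((t : ℂ) * Complex.I)) (ENNReal.ofReal p) (meanMeasure T)
      = ENNReal.ofReal (dirMean p a T ^ (1 / p)) := by
  have := isProb_meanMeasure hT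
  obtain ⟨⟨hc, B, hB⟩, -⟩ := trigAlg_mean (dirEval_mem_trigAlg a)
  have hm : MemLp (fun t : ℝ => dirEval a ((t : ℂ) * Complex.I)) (ENNReal.ofReal p)
      (meanMeasure T) :=
    MemLp.of_bound hc.aestronglyMeasurable B (Eventually.of_forall hB)
  refine ⟨hm, ?_⟩
  rw [hm.eLpNorm_eq_integral_rpow_norm (by simp; linarith) (by simp)]
  rw [ENNReal.toReal_ofReal (by linarith), one_div, meanMeasure, integral_smul_measure,
    ENNReal.toReal_ofReal (by positivity), dirMean, intervalIntegral.integral_of_le hT.le,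
    smul_eq_mul]

lemma dirNorm_nonneg (p : ℝ) (hp : 0 ≤ p) (a : ℕ+ →₀ ℂ) : 0 ≤ dirNorm p a :=
  ge_of_tendsto (tendsto_dirMean_rpow p hp a) <| by
    filter_upwards [eventually_gt_atTop 0] with T hT
    exact Real.rpow_nonneg (dirMean_nonneg p a hT) _

lemma dirNorm_add_le (p : ℝ) (hp : 1 ≤ p) (a b : ℕ+ →₀ ℂ) :
    dirNorm p (a + b) ≤ dirNorm p a + dirNorm p b := by
  have hp0 : 0 ≤ p := by linarith
  refine le_of_tendsto_of_tendsto (tendsto_dirMean_rpow p hp0 _)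
    ((tendsto_dirMean_rpow p hp0 a).add (tendsto_dirMean_rpow p hp0 b)) ?_
  filter_upwards [eventually_gt_atTop 0] with T hT
  have ha := eLpNorm_meanMeasure p hp a hT
  have hb := eLpNorm_meanMeasure p hp b hT
  have hab := (eLpNorm_meanMeasure p hp (a + b) hT).2
  have key := eLpNorm_add_le ha.1.1 hb.1.1 (ENNReal.one_le_ofReal.2 hp)
  have heq : (fun t : ℝ => dirEval (a + b) ((t : ℂ) * Complex.I))
      = (fun t : ℝ => dirEval a ((t : ℂ) * Complex.I))
        + fun t : ℝ => dirEval b ((t : ℂ) * Complex.I) := by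
    ext t; exact dirEval_add a b _
  rw [heq] at hab
  rw [hab, ha.2, hb.2, ← ENNReal.ofReal_add (Real.rpow_nonneg (dirMean_nonneg p a hT) _)
    (Real.rpow_nonneg (dirMean_nonneg p b hT) _)] at key
  exact (ENNReal.ofReal_le_ofReal_iff (add_nonneg (Real.rpow_nonneg (dirMean_nonneg p a hT) _)
    (Real.rpow_nonneg (dirMean_nonneg p b hT) _))).1 key

lemma dirNorm_smul (p : ℝ) (hp : 1 ≤ p) (c : ℂ) (a : ℕ+ →₀ ℂ) :
    dirNorm p (c • a) = ‖c‖ * dirNorm p a := by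
  have hp0 : 0 < p := by linarith
  refine tendsto_nhds_unique (tendsto_dirMean_rpow p hp0.le _)
    (((tendsto_dirMean_rpow p hp0.le a).const_mul ‖c‖).congr' ?_)
  filter_upwards [eventually_gt_atTop 0] with T hT
  have : dirMean p (c • a) T = ‖c‖ ^ p * dirMean p a T := by
    unfold dirMean
    simp_rw [dirEval_smul, norm_mul, Real.mul_rpow (norm_nonneg _) (norm_nonneg _)]
    rw [intervalIntegral.integral_const_mul]
    ring
  rw [this, Real.mul_rpow (by positivity) (dirMean_nonneg p a hT), ← Real.rpow_mul (norm_nonneg _),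
    mul_one_div_cancel hp0.ne', Real.rpow_one]

lemma tendsto_coeff_mean (a : ℕ+ →₀ ℂ) (n : ℕ+) :
    Tendsto (fun T : ℝ => ((1 / T : ℝ) : ℂ) *
      ∫ t in (0 : ℝ)..T, dirEval a ((t : ℂ) * Complex.I) * meanExp (Real.log (n : ℕ)) t)
      atTop (𝓝 (a n)) := by
  have h : ∀ T : ℝ, ((1 / T : ℝ) : ℂ) *
      ∫ t in (0 : ℝ)..T, dirEval a ((t : ℂ) * Complex.I) * meanExp (Real.log (n : ℕ)) t
      = ∑ m ∈ a.support, a m * (((1 / T : ℝ) : ℂ) *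
        ∫ t in (0 : ℝ)..T, meanExp (Real.log (n : ℕ) - Real.log (m : ℕ)) t) := by
    intro T
    have h1 : (fun t : ℝ => dirEval a ((t : ℂ) * Complex.I) * meanExp (Real.log (n : ℕ)) t)
        = fun t : ℝ => ∑ m ∈ a.support,
          a m * meanExp (Real.log (n : ℕ) - Real.log (m : ℕ)) t := by
      ext t
      simp only [dirEval, Finsupp.sum, meanExp, Finset.sum_mul]
      refine Finset.sum_congr rfl fun m _ => ?_
      have hm : (((m : ℕ) : ℂ)) ≠ 0 := by simp
      rw [Complex.cpow_def_of_ne_zero hm, Complex.natCast_log.symm, mul_assoc, ← Complex.exp_add]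
      congr 2
      push_cast
      ring
    have hi : ∀ m ∈ a.support, IntervalIntegrable
        (fun t => a m * meanExp (Real.log (n : ℕ) - Real.log (m : ℕ)) t) volume 0 T :=
      fun m _ => (continuous_const.mul (continuous_meanExp _)).intervalIntegrable _ _
    rw [h1, intervalIntegral.integral_finsetSum hi, Finset.mul_sum]
    refine Finset.sum_congr rfl fun m _ => ?_
    rw [intervalIntegral.integral_const_mul]
    ring
  simp_rw [h]
  have h2 := tendsto_finsetSum a.support fun m _ =>
    (tendsto_mean_meanExp (Real.log (n : ℕ) - Real.log (m : ℕ))).const_mul (a m)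
  convert h2 using 2
  have h3 : ∀ m : ℕ+, (Real.log (n : ℕ) - Real.log (m : ℕ) = 0) ↔ n = m := by
    intro m
    rw [sub_eq_zero]
    constructor
    · intro h
      have := Real.log_injOn_pos (by simp) (by simp) h
      exact_mod_cast this
    · rintro rfl; rfl
  simp [h3]

lemma norm_coeff_le (p : ℝ) (hp : 1 ≤ p) (a : ℕ+ →₀ ℂ) (n : ℕ+) : ‖a n‖ ≤ dirNorm p a := by
  have hp0 : 0 ≤ p := by linarith
  refine le_of_tendsto_of_tendsto (tendsto_coeff_mean a n).norm (tendsto_dirMean_rpow p hp0 a) ?_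
  filter_upwards [eventually_gt_atTop 0] with T hT
  have := isProb_meanMeasure hT
  have hpp := eLpNorm_meanMeasure p hp a hT
  have h1 := eLpNorm_meanMeasure 1 le_rfl a hT
  have hle : eLpNorm (fun t : ℝ => dirEval a ((t : ℂ) * Complex.I)) (ENNReal.ofReal 1)
      (meanMeasure T) ≤ eLpNorm (fun t : ℝ => dirEval a ((t : ℂ) * Complex.I)) (ENNReal.ofReal p)
      (meanMeasure T) :=
    eLpNorm_le_eLpNorm_of_exponent_le (ENNReal.ofReal_le_ofReal hp) hpp.1.1
  rw [h1.2, hpp.2, ENNReal.ofReal_le_ofReal_iff (Real.rpow_nonneg (dirMean_nonneg p a hT) _)] at hle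
  refine le_trans ?_ hle
  rw [norm_mul, Complex.norm_real, Real.norm_of_nonneg (by positivity)]
  simp only [dirMean, Real.rpow_one, div_one]
  gcongr
  refine (intervalIntegral.norm_integral_le_integral_norm hT.le).trans (le_of_eq ?_)
  congr 1
  ext t
  have : ((Real.log (n : ℕ) : ℝ) : ℂ) * t * Complex.I
      = ((Real.log (n : ℕ) * t : ℝ) : ℂ) * Complex.I := by push_cast; ring
  rw [norm_mul, meanExp, this, Complex.norm_exp_ofReal_mul_I, mul_one]

/-! ### The spaces `H^p` and `H^p_0` -/

/-- The vector space of Dirichlet polynomials, to be normed by `dirNorm p`. -/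
def DirPoly (_p : ℝ) : Type := ℕ+ →₀ ℂ

namespace DirPoly

variable (p : ℝ)

instance : AddCommGroup (DirPoly p) := inferInstanceAs (AddCommGroup (ℕ+ →₀ ℂ))

instance : Module ℂ (DirPoly p) := inferInstanceAs (Module ℂ (ℕ+ →₀ ℂ))

instance : Norm (DirPoly p) := ⟨fun P => dirNorm p P⟩

/-- The finitely supported coefficient sequence of a Dirichlet polynomial. -/
def coeffs : DirPoly p ≃ₗ[ℂ] (ℕ+ →₀ ℂ) := LinearEquiv.refl ℂ (ℕ+ →₀ ℂ)

variable {p} in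
/-- The value `P(s)` of a Dirichlet polynomial. -/
def eval (P : DirPoly p) (s : ℂ) : ℂ := dirEval (coeffs p P) s

lemma normedCore [hp : Fact (1 ≤ p)] : NormedSpace.Core ℂ (DirPoly p) where
  norm_nonneg P := dirNorm_nonneg p (by linarith [hp.out]) P
  norm_smul c P := dirNorm_smul p hp.out c P
  norm_triangle P Q := dirNorm_add_le p hp.out P Q
  norm_eq_zero_iff P := by
    constructor
    · intro h
      refine Finsupp.ext fun n => ?_
      have := norm_coeff_le p hp.out P n
      exact norm_le_zero_iff.1 (this.trans h.le)
    · rintro rfl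
      have h : dirNorm p 0 = 0 := by simpa using dirNorm_smul p hp.out 0 0
      exact h

instance [Fact (1 ≤ p)] : NormedAddCommGroup (DirPoly p) :=
  NormedAddCommGroup.ofCore (normedCore p)

instance [Fact (1 ≤ p)] : NormedSpace ℂ (DirPoly p) := NormedSpace.ofCore (normedCore p)

/-- The `n`-th coefficient, a linear functional of norm at most one on Dirichlet polynomials. -/
def coeffCLM [hp : Fact (1 ≤ p)] (n : ℕ+) : DirPoly p →L[ℂ] ℂ :=
  LinearMap.mkContinuous (Finsupp.lapply n ∘ₗ (coeffs p).toLinearMap) 1 fun P => by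
    rw [one_mul]
    exact norm_coeff_le p hp.out P n

end DirPoly

/-- `H^p`: the completion of the Dirichlet polynomials in the norm
`(lim_{T → ∞} (1/T) ∫_0^T |P(it)|^p dt)^{1/p}`. -/
abbrev DirHardy (p : ℝ) [Fact (1 ≤ p)] : Type := UniformSpace.Completion (DirPoly p)

namespace DirHardy

variable {p : ℝ} [Fact (1 ≤ p)]

/-- The `n`-th Dirichlet coefficient of an element of `H^p`: the continuous extension of the
`n`-th coefficient of Dirichlet polynomials. -/
def coeff (n : ℕ+) : DirHardy p →L[ℂ] ℂ :=
  (DirPoly.coeffCLM p n).extend UniformSpace.Completion.toComplL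

lemma coeff_coe (n : ℕ+) (P : DirPoly p) :
    coeff n (P : DirHardy p) = DirPoly.coeffs p P n :=
  ContinuousLinearMap.extend_eq (DirPoly.coeffCLM p n)
    (e := (UniformSpace.Completion.toComplL : DirPoly p →L[ℂ] DirHardy p))
    UniformSpace.Completion.denseRange_coe (UniformSpace.Completion.isUniformInducing_coe _) P

/-- The function `f(s) = ∑ aₙ n^{-s}`, `Re s > 1/2`, given by the Dirichlet series of `f ∈ H^p`. -/
def toFun (f : DirHardy p) (s : ℂ) : ℂ := ∑' n : ℕ+, coeff n f * ((n : ℕ) : ℂ) ^ (-s)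

lemma toFun_coe (P : DirPoly p) (s : ℂ) : toFun (P : DirHardy p) s = P.eval s := by
  simp only [toFun, coeff_coe, DirPoly.eval, dirEval, Finsupp.sum]
  exact tsum_eq_sum fun n hn => by simp [Finsupp.notMem_support_iff.1 hn]

end DirHardy

/-- `H^p_0`: the subspace of `H^p` of Dirichlet series `∑_{n ≥ 2} aₙ n^{-s}`, which vanish
at `+∞`. -/
def DirHardyZero (p : ℝ) [Fact (1 ≤ p)] : Submodule ℂ (DirHardy p) :=
  LinearMap.ker (DirHardy.coeff (p := p) 1).toLinearMap

/-- The integral operator `Hf(s) = ∫_{1/2}^∞ f(w) (ζ(w + s) - 1) dw`. -/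
def mulHilbert (f : ℂ → ℂ) (s : ℂ) : ℂ :=
  ∫ w in Set.Ioi (1 / 2 : ℝ), f (w : ℂ) * (riemannZeta ((w : ℂ) + s) - 1)

end

/-!
The kernel `ζ(w + s) - 1` turns a pairing of the transform into the integral of a product: if
`f ∈ H^p_0` is a Dirichlet polynomial and `gₙ` are the coefficients of `H f`, then
`∑ bₙ gₙ = ∫_{1/2}^∞ f(w) B(w) dw` for every Dirichlet polynomial `B = ∑ bₙ n^{-s}` with `b₁ = 0`.

Take for `f`, up to its constant term, the Euler product `∏ (1 + (2/p) q^{-σ} q^{-s})`, where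
`σ = 1/2 + δ` and `q` runs over finitely many large primes, and for `B` the analytic part of a
trigonometric polynomial that approximates `|K|^{p-2} K` for `K = ∏ (1 + q^{-σ+it})`. With
`S = ∑ q^{-2σ}`, and up to factors `exp (ε S)`, the norm of `f` is at most `exp (S / p)`, by
Hölder's inequality `B` defines a functional on `H^p` of norm at most `exp ((p - 1) S / 4)`, and
the values `f(σ)`, `B(σ)` are at least `exp (2 S / p)`, `exp ((p / 2 - 1 / 4) S)`. Since all
coefficients are nonnegative, the integral is at least `δ f(σ) B(σ)`, so boundedness would give
`δ exp ((1 / p + p / 4) S) ≤ C exp (4 ε S)`. But `δ` can be arbitrarily small with `δ exp S`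
bounded below, and `1 / p + p / 4 > 1` unless `p = 2`.
-/

noncomputable section

/-! ### Mean values over the half-line -/

/-- `f` has mean value `c` over `[0, ∞)`. -/
def HasMean (f : ℝ → ℂ) (c : ℂ) : Prop :=
  Tendsto (fun T : ℝ => ((1 / T : ℝ) : ℂ) * ∫ t in (0 : ℝ)..T, f t) atTop (𝓝 c)

/-- Dirichlet polynomials `∑ aₙ n^{-it}` are paired with `g` by averaging their product; this
pairing is `∑ Gₙ aₙ`, that is, `Gₙ` is the mean value of `n^{-it} g(t)` for every `n`. -/
def HasMeanCoeffs (g : ℝ → ℂ) (G : ℕ+ →₀ ℂ) : Prop :=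
  ∀ n : ℕ+, HasMean (fun t => meanExp (-Real.log (n : ℕ)) t * g t) (G n)

lemma HasMean.finsetSum {κ : Type*} {s : Finset κ} {f : κ → ℝ → ℂ} {c : κ → ℂ}
    (h : ∀ k ∈ s, HasMean (f k) (c k)) (hf : ∀ k ∈ s, Continuous (f k)) :
    HasMean (fun t => ∑ k ∈ s, f k t) (∑ k ∈ s, c k) := by
  refine (tendsto_finsetSum s h).congr fun T => ?_
  rw [intervalIntegral.integral_finsetSum fun k hk => (hf k hk).intervalIntegrable _ _,
    Finset.mul_sum]

lemma HasMean.const_mul {f : ℝ → ℂ} {c : ℂ} (h : HasMean f c) (a : ℂ) :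
    HasMean (fun t => a * f t) (a * c) := by
  refine (Tendsto.const_mul a h).congr fun T => ?_
  rw [intervalIntegral.integral_const_mul]
  ring

lemma HasMean.tendsto_real {f : ℝ → ℝ} {c : ℝ} (h : HasMean (fun t => (f t : ℂ)) c) :
    Tendsto (fun T : ℝ => 1 / T * ∫ t in (0 : ℝ)..T, f t) atTop (𝓝 c) := by
  refine ((Complex.continuous_re.tendsto _).comp h).congr fun T => ?_
  rw [Function.comp_apply, intervalIntegral.integral_ofReal, ← Complex.ofReal_mul,
    Complex.ofReal_re]

lemma meanExp_zero (t : ℝ) : meanExp 0 t = 1 := by simp [meanExp]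

lemma meanExp_add (l m t : ℝ) : meanExp (l + m) t = meanExp l t * meanExp m t := by
  simp only [meanExp, ← Complex.exp_add]
  congr 1
  push_cast
  ring

lemma meanExp_sum {κ : Type*} (s : Finset κ) (l : κ → ℝ) (t : ℝ) :
    meanExp (∑ k ∈ s, l k) t = ∏ k ∈ s, meanExp (l k) t := by
  simp only [meanExp, ← Complex.exp_sum, Complex.ofReal_sum, Finset.sum_mul]

lemma dirEval_mul_I (P : ℕ+ →₀ ℂ) (t : ℝ) :
    dirEval P ((t : ℂ) * Complex.I) = P.sum fun n a => a * meanExp (-Real.log (n : ℕ)) t := by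
  refine Finset.sum_congr rfl fun n _ => ?_
  dsimp only
  rw [Complex.cpow_def_of_ne_zero (by simp), Complex.natCast_log.symm, meanExp]
  congr 2
  push_cast
  ring

lemma HasMeanCoeffs.hasMean_dirEval_mul {g : ℝ → ℂ} {G : ℕ+ →₀ ℂ} (h : HasMeanCoeffs g G)
    (hg : Continuous g) (P : ℕ+ →₀ ℂ) :
    HasMean (fun t => dirEval P ((t : ℂ) * Complex.I) * g t) (G.sum fun n b => b * P n) := by
  have pairing_comm : (G.sum fun n b => b * P n) = P.sum fun n a => a * G n := by
    rw [Finsupp.sum_of_support_subset G Finset.subset_union_left _ (by simp),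
      Finsupp.sum_of_support_subset P (Finset.subset_union_right (s₁ := G.support)) _ (by simp)]
    exact Finset.sum_congr rfl fun n _ => mul_comm _ _
  simp_rw [pairing_comm, dirEval_mul_I, Finsupp.sum, Finset.sum_mul, mul_assoc]
  exact HasMean.finsetSum (fun n _ => (h n).const_mul _)
    fun n _ => continuous_const.mul ((continuous_meanExp _).mul hg)

/-! ### Mean values and the norm of `H^p` -/

lemma integral_meanMeasure {E : Type*} [NormedAddCommGroup E] [NormedSpace ℝ E] (f : ℝ → E)
    {T : ℝ} (hT : 0 < T) : ∫ t, f t ∂meanMeasure T = (1 / T) • ∫ t in (0 : ℝ)..T, f t := by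
  rw [meanMeasure, integral_smul_measure, ENNReal.toReal_ofReal (by positivity),
    intervalIntegral.integral_of_le hT.le]

lemma integrable_meanMeasure {E : Type*} [NormedAddCommGroup E] {f : ℝ → E} (hf : Continuous f)
    (T : ℝ) : Integrable f (meanMeasure T) :=
  Integrable.smul_measure hf.integrableOn_Ioc ENNReal.ofReal_ne_top

lemma integral_rpow_mul_rpow_le {α : Type*} [MeasurableSpace α] {μ : Measure α} {f g : α → ℝ}
    (hf : Integrable f μ) (hg : Integrable g μ) (hf0 : 0 ≤ f) (hg0 : 0 ≤ g)
    {r s : ℝ} (hr : 0 ≤ r) (hs : 0 ≤ s) (hrs : r + s = 1) :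
    ∫ x, f x ^ r * g x ^ s ∂μ ≤ (∫ x, f x ∂μ) ^ r * (∫ x, g x ∂μ) ^ s := by
  have hfi : 0 ≤ ∫ x, f x ∂μ := integral_nonneg hf0
  have hgi : 0 ≤ ∫ x, g x ∂μ := integral_nonneg hg0
  have ofReal_rpow_mul_rpow {a b : ℝ} (ha : 0 ≤ a) (hb : 0 ≤ b) :
      ENNReal.ofReal a ^ r * ENNReal.ofReal b ^ s = ENNReal.ofReal (a ^ r * b ^ s) := by
    rw [ENNReal.ofReal_rpow_of_nonneg ha hr, ENNReal.ofReal_rpow_of_nonneg hb hs,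
      ← ENNReal.ofReal_mul (Real.rpow_nonneg ha _)]
  have holder := ENNReal.lintegral_mul_norm_pow_le (μ := μ)
    hf.1.aemeasurable.ennreal_ofReal hg.1.aemeasurable.ennreal_ofReal hr hs hrs
  simp_rw [ofReal_rpow_mul_rpow (hf0 _) (hg0 _)] at holder
  rw [← ofReal_integral_eq_lintegral_ofReal hf (Eventually.of_forall hf0),
    ← ofReal_integral_eq_lintegral_ofReal hg (Eventually.of_forall hg0),
    ofReal_rpow_mul_rpow hfi hgi] at holder
  rw [integral_eq_lintegral_of_nonneg_ae (Eventually.of_forall fun x =>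
    mul_nonneg (Real.rpow_nonneg (hf0 x) _) (Real.rpow_nonneg (hg0 x) _))
    ((hf.1.aemeasurable.pow_const r).mul (hg.1.aemeasurable.pow_const s)).aestronglyMeasurable]
  exact ENNReal.toReal_le_of_le_ofReal (mul_nonneg (Real.rpow_nonneg hfi _)
    (Real.rpow_nonneg hgi _)) holder

lemma norm_mean_dirEval_mul_le {p : ℝ} (hp : 1 ≤ p) (P : ℕ+ →₀ ℂ) {g : ℝ → ℂ}
    (hg : Continuous g) {V : ℝ → ℝ} (hV : Continuous V) (hV0 : 0 ≤ V) {K : ℝ} (hK : 0 ≤ K)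
    (hgV : ∀ t, ‖g t‖ ≤ K * V t ^ (1 - 1 / p)) {T : ℝ} (hT : 0 < T) :
    ‖((1 / T : ℝ) : ℂ) * ∫ t in (0 : ℝ)..T, dirEval P ((t : ℂ) * Complex.I) * g t‖
      ≤ K * (dirMean p P T ^ (1 / p) * (1 / T * ∫ t in (0 : ℝ)..T, V t) ^ (1 - 1 / p)) := by
  have hp0 : 0 < p := by linarith
  have hr1 : 0 ≤ 1 - 1 / p := sub_nonneg.2 ((div_le_one hp0).2 hp)
  have hP := continuous_dirEval_I P
  have hPp := hP.norm.rpow_const (p := p) fun _ => Or.inr hp0.le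
  have rpow_inv_rpow (t : ℝ) : (‖dirEval P (t * Complex.I)‖ ^ p) ^ (1 / p)
      = ‖dirEval P (t * Complex.I)‖ := by
    rw [← Real.rpow_mul (norm_nonneg _), mul_one_div_cancel hp0.ne', Real.rpow_one]
  calc
    _ = ‖∫ t, dirEval P ((t : ℂ) * Complex.I) * g t ∂meanMeasure T‖ := by
      rw [integral_meanMeasure _ hT, Complex.real_smul]
    _ ≤ ∫ t, ‖dirEval P ((t : ℂ) * Complex.I) * g t‖ ∂meanMeasure T :=
      norm_integral_le_integral_norm _
    _ ≤ ∫ t, K * ((‖dirEval P ((t : ℂ) * Complex.I)‖ ^ p) ^ (1 / p) * V t ^ (1 - 1 / p))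
          ∂meanMeasure T := by
      refine integral_mono (integrable_meanMeasure (hP.mul hg).norm T)
        (integrable_meanMeasure (continuous_const.mul
          ((hPp.rpow_const fun _ => Or.inr (by positivity)).mul
            (hV.rpow_const fun _ => Or.inr hr1))) T) fun t => ?_
      dsimp only
      rw [norm_mul, rpow_inv_rpow, mul_left_comm]
      gcongr
      exact hgV t
    _ ≤ K * ((∫ t, ‖dirEval P ((t : ℂ) * Complex.I)‖ ^ p ∂meanMeasure T) ^ (1 / p)
          * (∫ t, V t ∂meanMeasure T) ^ (1 - 1 / p)) := by
      rw [integral_const_mul]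
      gcongr
      exact integral_rpow_mul_rpow_le (integrable_meanMeasure hPp T)
        (integrable_meanMeasure hV T) (fun t => by positivity) hV0 (by positivity) hr1
        (add_sub_cancel _ _)
    _ = _ := by
      rw [integral_meanMeasure _ hT, integral_meanMeasure _ hT, smul_eq_mul, smul_eq_mul, dirMean]

lemma HasMeanCoeffs.norm_sum_mul_coeff_le {p : ℝ} [hp : Fact (1 ≤ p)] {g : ℝ → ℂ}
    {G : ℕ+ →₀ ℂ} (h : HasMeanCoeffs g G) (hg : Continuous g) {V : ℝ → ℝ} (hV : Continuous V)
    (hV0 : 0 ≤ V) {v : ℝ} (hVv : HasMean (fun t => (V t : ℂ)) v) {K : ℝ} (hK : 0 ≤ K)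
    (hgV : ∀ t, ‖g t‖ ≤ K * V t ^ (1 - 1 / p)) (F : DirHardy p) :
    ‖G.sum fun n b => b * DirHardy.coeff n F‖ ≤ K * v ^ (1 - 1 / p) * ‖F‖ := by
  have hp0 : 0 < p := by linarith [hp.out]
  have hr1 : 0 ≤ 1 - 1 / p := sub_nonneg.2 ((div_le_one hp0).2 hp.out)
  induction F using UniformSpace.Completion.induction_on with
  | hp => exact isClosed_le (by simp only [Finsupp.sum]; fun_prop) (by fun_prop)
  | ih P =>
    have mean_bound := (tendsto_dirMean_rpow p hp0.le (DirPoly.coeffs p P)).mul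
      (hVv.tendsto_real.rpow_const (p := 1 - 1 / p) (Or.inr hr1))
    rw [UniformSpace.Completion.norm_coe, mul_assoc, mul_comm (v ^ (1 - 1 / p))]
    simp_rw [DirHardy.coeff_coe]
    refine le_of_tendsto_of_tendsto (h.hasMean_dirEval_mul hg (DirPoly.coeffs p P)).norm
      (mean_bound.const_mul K) ?_
    filter_upwards [eventually_gt_atTop 0] with T hT
    exact norm_mean_dirEval_mul_le hp.out _ hg hV hV0 hK hgV hT

lemma dirNorm_le_of_rpow_le {p : ℝ} (hp : 0 < p) (P : ℕ+ →₀ ℂ) {V : ℝ → ℝ} (hV : Continuous V)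
    (hPV : ∀ t : ℝ, ‖dirEval P ((t : ℂ) * Complex.I)‖ ^ p ≤ V t) {v : ℝ}
    (hVv : HasMean (fun t => (V t : ℂ)) v) : dirNorm p P ≤ v ^ (1 / p) := by
  refine le_of_tendsto_of_tendsto (tendsto_dirMean_rpow p hp.le P)
    (hVv.tendsto_real.rpow_const (p := 1 / p) (Or.inr (by positivity))) ?_
  filter_upwards [eventually_gt_atTop 0] with T hT
  refine Real.rpow_le_rpow (dirMean_nonneg p P hT) ?_ (by positivity)
  rw [dirMean]
  gcongr
  refine intervalIntegral.integral_mono_on hT.le ?_ (hV.intervalIntegrable _ _) fun t _ => hPV t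
  exact ((continuous_dirEval_I P).norm.rpow_const fun _ => Or.inr hp.le).intervalIntegrable _ _

/-! ### Products over finitely many primes -/

lemma dirEval_single (n : ℕ+) (a s : ℂ) :
    dirEval (Finsupp.single n a) s = a * ((n : ℕ) : ℂ) ^ (-s) :=
  Finsupp.sum_single_index (zero_mul _)

lemma dirEval_sum {κ : Type*} (s : Finset κ) (f : κ → ℕ+ →₀ ℂ) (z : ℂ) :
    dirEval (∑ k ∈ s, f k) z = ∑ k ∈ s, dirEval (f k) z :=
  map_sum (AddMonoidHom.mk' (dirEval · z) fun a b => dirEval_add a b z) f s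

lemma natCast_prod_cpow {κ : Type*} (s : Finset κ) (m : κ → ℕ) (z : ℂ) :
    ((∏ k ∈ s, m k : ℕ) : ℂ) ^ z = ∏ k ∈ s, (m k : ℂ) ^ z := by
  classical
  induction s using Finset.induction_on with
  | empty => simp
  | insert k s hk ih =>
    rw [Finset.prod_insert hk, Finset.prod_insert hk, Nat.cast_mul,
      Complex.natCast_mul_natCast_cpow, ih]

section

variable {ι : Type*} [Fintype ι] (q : ι ↪ Nat.Primes)

/-- The positive integer `∏ qᵢ^{kᵢ}`, where the `qᵢ` are distinct primes. -/
def primeProd (k : ι → ℕ) : ℕ+ := ∏ i, (q i : ℕ+) ^ k i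

lemma coe_primeProd (k : ι → ℕ) : (primeProd q k : ℕ) = ∏ i, (q i : ℕ) ^ k i := by
  simp only [primeProd, Finset.PNat.coe_prod, PNat.pow_coe, Nat.Primes.coe_pnat_nat]

lemma log_primeProd (k : ι → ℕ) :
    Real.log (primeProd q k : ℕ) = ∑ i, k i * Real.log (q i) := by
  rw [coe_primeProd, Nat.cast_prod,
    Real.log_prod fun i _ => by exact_mod_cast pow_ne_zero _ (q i).2.ne_zero]
  simp

lemma primeProd_cpow (k : ι → ℕ) (s : ℂ) :
    ((primeProd q k : ℕ) : ℂ) ^ s = ∏ i, ((q i : ℂ) ^ s) ^ k i := by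
  rw [coe_primeProd, natCast_prod_cpow]
  refine Finset.prod_congr rfl fun i _ => ?_
  rw [Nat.cast_pow, ← Complex.natCast_cpow_natCast_mul, mul_comm, Complex.cpow_mul_nat]

lemma coe_dvd_primeProd_iff {i : ι} {k : ι → ℕ} : (q i : ℕ) ∣ primeProd q k ↔ k i ≠ 0 := by
  rw [coe_primeProd, Prime.dvd_finsetProd_iff (q i).2.prime]
  constructor
  · rintro ⟨j, -, hj⟩ hki
    have hij : i = j := q.injective (Nat.Primes.coe_nat_injective
      ((Nat.prime_dvd_prime_iff_eq (q i).2 (q j).2).1 ((q i).2.dvd_of_dvd_pow hj)))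
    subst hij
    rw [hki, pow_zero] at hj
    exact (q i).2.one_lt.ne' (Nat.dvd_one.1 hj)
  · exact fun hki => ⟨i, Finset.mem_univ i, dvd_pow_self _ hki⟩

lemma primeProd_eq_one_iff {k : ι → ℕ} : primeProd q k = 1 ↔ k = 0 := by
  constructor
  · intro h
    by_contra hk
    obtain ⟨i, hi⟩ := Function.ne_iff.1 hk
    have hdvd := (coe_dvd_primeProd_iff q).2 hi
    rw [h, PNat.one_coe, Nat.dvd_one] at hdvd
    exact (q i).2.one_lt.ne' hdvd
  · rintro rfl
    simp [primeProd]

lemma sum_mul_log_eq_log_iff (k : ι → ℤ) (n : ℕ+) :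
    ∑ i, (k i : ℝ) * Real.log (q i) = Real.log (n : ℕ) ↔
      (∀ i, 0 ≤ k i) ∧ primeProd q (fun i => (k i).toNat) = n := by
  constructor
  · intro h
    have split_signs : primeProd q (fun i => (k i).toNat)
        = n * primeProd q (fun i => (-k i).toNat) := by
      refine PNat.coe_injective (Nat.cast_injective (R := ℝ) (Real.log_injOn_pos
        (Set.mem_Ioi.2 (Nat.cast_pos.2 (PNat.pos _)))
        (Set.mem_Ioi.2 (Nat.cast_pos.2 (PNat.pos _))) ?_))
      rw [PNat.mul_coe, Nat.cast_mul, Real.log_mul (by simp) (by simp), log_primeProd,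
        log_primeProd, ← h, ← Finset.sum_add_distrib]
      refine Finset.sum_congr rfl fun i _ => ?_
      have hki : (k i : ℝ) = ((k i).toNat : ℝ) - ((-k i).toNat : ℝ) := by
        exact_mod_cast (Int.toNat_sub_toNat_neg (k i)).symm
      rw [hki]
      ring
    have hk (i : ι) : 0 ≤ k i := by
      by_contra! hi
      have hdvd : (q i : ℕ) ∣ primeProd q fun i => (-k i).toNat :=
        (coe_dvd_primeProd_iff q).2 (by omega)
      have hdvd' := hdvd.mul_left (n : ℕ)
      rw [← PNat.mul_coe, ← split_signs, coe_dvd_primeProd_iff] at hdvd'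
      omega
    have no_denominator : primeProd q (fun i => (-k i).toNat) = 1 :=
      (primeProd_eq_one_iff q).2 (funext fun i => Int.toNat_of_nonpos (neg_nonpos.2 (hk i)))
    exact ⟨hk, by rw [split_signs, no_denominator, mul_one]⟩
  · rintro ⟨hk, rfl⟩
    rw [log_primeProd]
    refine Finset.sum_congr rfl fun i _ => ?_
    congr 1
    exact_mod_cast (Int.toNat_of_nonneg (hk i)).symm

/-- The trigonometric polynomial `∏ᵢ ∑_{|k| ≤ d} cᵢₖ qᵢ^{ikt}`. -/
def laurentProd (d : ℕ) (c : ι → ℤ → ℂ) (t : ℝ) : ℂ :=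
  ∏ i, ∑ k ∈ Finset.Icc (-d : ℤ) d, c i k * meanExp (k * Real.log (q i)) t

lemma continuous_laurentProd (d : ℕ) (c : ι → ℤ → ℂ) : Continuous (laurentProd q d c) :=
  continuous_finsetProd _ fun _ _ => continuous_finsetSum _ fun _ _ =>
    continuous_const.mul (continuous_meanExp _)

variable [DecidableEq ι]

/-- The coefficients of the Dirichlet polynomial `∏ᵢ ∑_{k ≤ d} cᵢₖ qᵢ^{-ks}`. -/
def eulerPoly (d : ℕ) (c : ι → ℕ → ℂ) : ℕ+ →₀ ℂ :=
  ∑ k ∈ Fintype.piFinset fun _ => Finset.range (d + 1),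
    Finsupp.single (primeProd q k) (∏ i, c i (k i))

lemma dirEval_eulerPoly (d : ℕ) (c : ι → ℕ → ℂ) (s : ℂ) :
    dirEval (eulerPoly q d c) s
      = ∏ i, ∑ k ∈ Finset.range (d + 1), c i k * ((q i : ℂ) ^ (-s)) ^ k := by
  simp_rw [eulerPoly, dirEval_sum, dirEval_single, primeProd_cpow, ← Finset.prod_mul_distrib]
  rw [Finset.prod_univ_sum]

lemma eulerPoly_apply (d : ℕ) (c : ι → ℕ → ℂ) (n : ℕ+) :
    eulerPoly q d c n = ∑ k ∈ Fintype.piFinset fun _ => Finset.range (d + 1),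
      if primeProd q k = n then ∏ i, c i (k i) else 0 := by
  simp only [eulerPoly, Finsupp.finsetSum_apply, Finsupp.single_apply]

lemma eulerPoly_apply_one (d : ℕ) (c : ι → ℕ → ℂ) : eulerPoly q d c 1 = ∏ i, c i 0 := by
  simp only [eulerPoly_apply, primeProd_eq_one_iff]
  rw [Finset.sum_ite_eq' _ (0 : ι → ℕ), if_pos (Fintype.mem_piFinset.2 fun _ => by simp)]
  rfl

lemma laurentProd_eq_sum (d : ℕ) (c : ι → ℤ → ℂ) (t : ℝ) :
    laurentProd q d c t = ∑ k ∈ Fintype.piFinset fun _ => Finset.Icc (-d : ℤ) d,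
      (∏ i, c i (k i)) * meanExp (∑ i, k i * Real.log (q i)) t := by
  simp_rw [laurentProd, Finset.prod_univ_sum, Finset.prod_mul_distrib, meanExp_sum]

lemma hasMeanCoeffs_laurentProd (d : ℕ) (c : ι → ℤ → ℂ) :
    HasMeanCoeffs (laurentProd q d c) (eulerPoly q d fun i k => c i k) := by
  intro n
  have shift_frequency (t : ℝ) : meanExp (-Real.log (n : ℕ)) t * laurentProd q d c t
      = ∑ k ∈ Fintype.piFinset fun _ => Finset.Icc (-d : ℤ) d,
        (∏ i, c i (k i)) * meanExp (∑ i, k i * Real.log (q i) - Real.log (n : ℕ)) t := by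
    simp_rw [laurentProd_eq_sum, Finset.mul_sum, sub_eq_add_neg, meanExp_add]
    exact Finset.sum_congr rfl fun k _ => by ring
  have coeff_eq : eulerPoly q d (fun i k => c i k) n
      = ∑ k ∈ Fintype.piFinset fun _ => Finset.Icc (-d : ℤ) d, (∏ i, c i (k i)) *
        if ∑ i, k i * Real.log (q i) - Real.log (n : ℕ) = 0 then 1 else 0 := by
    simp only [eulerPoly_apply, sub_eq_zero, sum_mul_log_eq_log_iff, mul_ite, mul_one, mul_zero]
    rw [← Finset.sum_filter, ← Finset.sum_filter]
    refine Finset.sum_nbij' (fun k i => (k i : ℤ)) (fun k i => (k i).toNat) ?_ ?_ ?_ ?_ ?_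
    · intro k hk
      simp only [Finset.mem_filter, Fintype.mem_piFinset, Finset.mem_range, Finset.mem_Icc,
        Int.toNat_natCast] at hk ⊢
      exact ⟨fun i => by have := hk.1 i; omega, fun i => by omega, hk.2⟩
    · intro k hk
      simp only [Finset.mem_filter, Fintype.mem_piFinset, Finset.mem_range,
        Finset.mem_Icc] at hk ⊢
      exact ⟨fun i => by have := hk.1 i; omega, hk.2.2⟩
    · exact fun k _ => funext fun i => Int.toNat_natCast (k i)
    · exact fun k hk => funext fun i => Int.toNat_of_nonneg ((Finset.mem_filter.1 hk).2.1 i)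
    · exact fun _ _ => rfl
  simp_rw [shift_frequency, coeff_eq]
  exact HasMean.finsetSum (fun k _ => HasMean.const_mul (tendsto_mean_meanExp _) _)
    fun k _ => continuous_const.mul (continuous_meanExp _)

end

lemma hasMean_laurentProd {ι : Type*} [Fintype ι] (q : ι ↪ Nat.Primes) (d : ℕ) (c : ι → ℤ → ℂ) :
    HasMean (laurentProd q d c) (∏ i, c i 0) := by
  classical
  have h := hasMeanCoeffs_laurentProd q d c 1
  simpa [eulerPoly_apply_one, meanExp_zero] using h

/-! ### Trigonometric majorants -/

/-- The coefficients of the trigonometric polynomial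
`(a₀ + a₁ cos θ + a₂ cos 2θ) + i b₁ sin θ`. -/
def quadCoeff (a₀ a₁ a₂ b₁ : ℝ) (k : ℤ) : ℝ :=
  if k = 0 then a₀ else if k = 1 then (a₁ + b₁) / 2 else if k = -1 then (a₁ - b₁) / 2 else a₂ / 2

lemma meanExp_eq_cos_add_sin (l t : ℝ) :
    meanExp l t = Real.cos (l * t) + Real.sin (l * t) * Complex.I := by
  rw [meanExp, ← Complex.ofReal_mul, Complex.exp_mul_I, Complex.ofReal_cos, Complex.ofReal_sin]

lemma sum_quadCoeff_mul_meanExp (a₀ a₁ a₂ b₁ l t : ℝ) :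
    ∑ k ∈ Finset.Icc (-(2 : ℕ) : ℤ) (2 : ℕ), (quadCoeff a₀ a₁ a₂ b₁ k : ℂ) * meanExp (k * l) t
      = ((a₀ + a₁ * Real.cos (l * t) + a₂ * Real.cos (2 * (l * t)) : ℝ) : ℂ)
        + ((b₁ * Real.sin (l * t) : ℝ) : ℂ) * Complex.I := by
  have hIcc : Finset.Icc (-(2 : ℕ) : ℤ) (2 : ℕ) = {0, 1, -1, 2, -2} := by decide
  have quadCoeff_values : quadCoeff a₀ a₁ a₂ b₁ 0 = a₀ ∧ quadCoeff a₀ a₁ a₂ b₁ 1 = (a₁ + b₁) / 2 ∧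
      quadCoeff a₀ a₁ a₂ b₁ (-1) = (a₁ - b₁) / 2 ∧ quadCoeff a₀ a₁ a₂ b₁ 2 = a₂ / 2 ∧
      quadCoeff a₀ a₁ a₂ b₁ (-2) = a₂ / 2 := by simp [quadCoeff]
  obtain ⟨h0, h1, h1', h2, h2'⟩ := quadCoeff_values
  rw [hIcc, Finset.sum_insert (by decide), Finset.sum_insert (by decide),
    Finset.sum_insert (by decide), Finset.sum_pair (by decide), h0, h1, h1', h2, h2']
  simp only [meanExp_eq_cos_add_sin, mul_assoc]
  push_cast
  simp only [neg_mul, one_mul, zero_mul, Complex.cos_neg, Complex.sin_neg, Complex.cos_zero,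
    Complex.sin_zero]
  ring

/-- `φ` is at most `m + b cos θ + e cos 2θ` for some `b` and `e`, a trigonometric polynomial of
mean value `m`. -/
def CosMajorized (φ : ℝ → ℝ) (m : ℝ) : Prop :=
  ∃ b e : ℝ, ∀ θ, φ θ ≤ m + b * Real.cos θ + e * Real.cos (2 * θ)

lemma CosMajorized.mono {φ ψ : ℝ → ℝ} {m n : ℝ} (h : CosMajorized φ m) (hψ : ψ ≤ φ)
    (hmn : m ≤ n) : CosMajorized ψ n := by
  obtain ⟨b, e, hφ⟩ := h
  exact ⟨b, e, fun θ => by linarith [hφ θ, hψ θ]⟩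

lemma CosMajorized.exists_hasMean_prod {ι : Type*} [Fintype ι] (q : ι ↪ Nat.Primes)
    {φ : ι → ℝ → ℝ} {m : ι → ℝ} (hφ0 : ∀ i, 0 ≤ φ i) (hφ : ∀ i, CosMajorized (φ i) (m i)) :
    ∃ V : ℝ → ℝ, Continuous V ∧ (∀ t, ∏ i, φ i (Real.log (q i) * t) ≤ V t) ∧
      HasMean (fun t => (V t : ℂ)) ((∏ i, m i : ℝ) : ℂ) := by
  classical
  choose b e hbe using hφ
  refine ⟨fun t => ∏ i, (m i + b i * Real.cos (Real.log (q i) * t)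
    + e i * Real.cos (2 * (Real.log (q i) * t))), by fun_prop,
    fun t => Finset.prod_le_prod (fun i _ => hφ0 i _) fun i _ => hbe i _, ?_⟩
  convert hasMean_laurentProd q 2 fun i k => (quadCoeff (m i) (b i) (e i) 0 k : ℂ) using 1
  · funext t
    simp only [laurentProd, sum_quadCoeff_mul_meanExp]
    simp
  · simp [quadCoeff]

section

variable {ι : Type*} [Fintype ι] [DecidableEq ι] (q : ι ↪ Nat.Primes)

lemma dirNorm_eulerPoly_le {p : ℝ} (hp : 0 < p) {d : ℕ} {c : ι → ℕ → ℂ} {m : ι → ℝ}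
    (h : ∀ i, CosMajorized
      (fun θ => ‖∑ k ∈ Finset.range (d + 1), c i k * meanExp (-1) θ ^ k‖ ^ p) (m i)) :
    dirNorm p (eulerPoly q d c) ≤ (∏ i, m i) ^ (1 / p) := by
  obtain ⟨V, hV, hφV, hVm⟩ := CosMajorized.exists_hasMean_prod q (fun i θ => by positivity) h
  refine dirNorm_le_of_rpow_le hp _ hV (fun t => ?_) hVm
  have cpow_eq (i : ι) : (q i : ℂ) ^ (-((t : ℂ) * Complex.I))
      = meanExp (-1) (Real.log (q i) * t) := by
    rw [Complex.cpow_def_of_ne_zero (Nat.cast_ne_zero.2 (q i).2.ne_zero), ← Complex.natCast_log,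
      meanExp]
    congr 1
    push_cast
    ring
  rw [dirEval_eulerPoly, norm_prod, ← Real.finsetProd_rpow _ _ fun _ _ => norm_nonneg _]
  simp_rw [cpow_eq]
  exact hφV t

lemma norm_sum_eulerPoly_mul_coeff_le {p : ℝ} [hp : Fact (1 ≤ p)] {d : ℕ} {c : ι → ℤ → ℂ}
    {φ : ι → ℝ → ℝ} {K m : ι → ℝ} (hφ0 : ∀ i, 0 ≤ φ i) (hφ : ∀ i, CosMajorized (φ i) (m i))
    (hK : ∀ i, 0 ≤ K i) (hc : ∀ i θ, ‖∑ k ∈ Finset.Icc (-d : ℤ) d, c i k * meanExp k θ‖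
      ≤ K i * φ i θ ^ (1 - 1 / p)) (F : DirHardy p) :
    ‖(eulerPoly q d fun i k => c i k).sum fun n b => b * DirHardy.coeff n F‖
      ≤ (∏ i, K i) * (∏ i, m i) ^ (1 - 1 / p) * ‖F‖ := by
  have hr : 0 ≤ 1 - 1 / p :=
    sub_nonneg.2 ((div_le_one (zero_lt_one.trans_le hp.out)).2 hp.out)
  have hK0 : 0 ≤ ∏ i, K i := Finset.prod_nonneg fun i _ => hK i
  obtain ⟨V, hV, hφV, hVm⟩ := CosMajorized.exists_hasMean_prod q hφ0 hφ
  have hφ_prod (t : ℝ) : 0 ≤ ∏ i, φ i (Real.log (q i) * t) :=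
    Finset.prod_nonneg fun i _ => hφ0 i _
  refine (hasMeanCoeffs_laurentProd q d c).norm_sum_mul_coeff_le (continuous_laurentProd q d c) hV
    (fun t => (hφ_prod t).trans (hφV t)) hVm hK0 (fun t => ?_) F
  have meanExp_mul (k : ℤ) (l : ℝ) : meanExp (k * l) t = meanExp k (l * t) := by
    simp only [meanExp, Complex.ofReal_mul, mul_assoc]
  calc
    _ = ∏ i, ‖∑ k ∈ Finset.Icc (-d : ℤ) d, c i k * meanExp k (Real.log (q i) * t)‖ := by
      simp only [laurentProd, norm_prod, meanExp_mul]
    _ ≤ ∏ i, K i * φ i (Real.log (q i) * t) ^ (1 - 1 / p) :=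
      Finset.prod_le_prod (fun _ _ => norm_nonneg _) fun i _ => hc i _
    _ = (∏ i, K i) * (∏ i, φ i (Real.log (q i) * t)) ^ (1 - 1 / p) := by
      rw [Finset.prod_mul_distrib, Real.finsetProd_rpow _ _ fun i _ => hφ0 i _]
    _ ≤ _ := by
      gcongr
      · exact hφ_prod t
      · exact hφV t

end

/-! ### Second-order estimates -/

lemma eventually_one_add_rpow_le (r : ℝ) {ε : ℝ} (hε : 0 < ε) :
    ∀ᶠ v : ℝ in 𝓝 0, (1 + v) ^ r ≤ 1 + r * v + (r * (r - 1) / 2 + ε) * v ^ 2 := by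
  set A := r * (r - 1) / 2 + ε with hA
  have hasDerivAt_rpow (s : ℝ) {v : ℝ} (hv : -1 < v) :
      HasDerivAt (fun v : ℝ => (1 + v) ^ s) (s * (1 + v) ^ (s - 1)) v := by
    simpa using ((hasDerivAt_id v).const_add 1).rpow_const (p := s) (Or.inl (by simp; linarith))
  have deriv_eq : deriv (fun v : ℝ => 1 + r * v + A * v ^ 2 - (1 + v) ^ r)
      =ᶠ[𝓝 0] fun v => r + 2 * A * v - r * (1 + v) ^ (r - 1) := by
    filter_upwards [eventually_gt_nhds neg_one_lt_zero] with v hv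
    refine (((((hasDerivAt_id' v).const_mul r).const_add 1).fun_add
      ((hasDerivAt_pow 2 v).const_mul A)).fun_sub (hasDerivAt_rpow r hv)).deriv.trans ?_
    push_cast
    ring
  have deriv_deriv_eq : deriv (fun v : ℝ => r + 2 * A * v - r * (1 + v) ^ (r - 1)) 0 = 2 * ε := by
    refine ((((hasDerivAt_id' (0 : ℝ)).const_mul (2 * A)).const_add r).fun_sub
      ((hasDerivAt_rpow (r - 1) neg_one_lt_zero).const_mul r)).deriv.trans ?_
    rw [add_zero, Real.one_rpow, hA]
    ring
  have hmin := isLocalMin_of_deriv_deriv_pos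
    (f := fun v : ℝ => 1 + r * v + A * v ^ 2 - (1 + v) ^ r) (x₀ := 0)
    (by rw [deriv_eq.deriv_eq, deriv_deriv_eq]; positivity)
    (by rw [deriv_eq.eq_of_nhds]; simp)
    ((by fun_prop : ContinuousAt (fun v : ℝ => 1 + r * v + A * v ^ 2) 0).sub
      (hasDerivAt_rpow r neg_one_lt_zero).continuousAt)
  filter_upwards [hmin] with v hv
  simpa using hv

lemma eventually_exp_mul_le_one_add_mul {c d : ℝ} (hcd : d < c) :
    ∀ᶠ y : ℝ in 𝓝[≥] 0, Real.exp (d * y) ≤ 1 + c * y := by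
  have h1 : ∀ᶠ y : ℝ in 𝓝 0, 0 < 1 + c * y :=
    (by fun_prop : Continuous fun y : ℝ => 1 + c * y).continuousAt.eventually_const_lt (by simp)
  have h2 : ∀ᶠ y : ℝ in 𝓝 0, d * (1 + c * y) < c :=
    (by fun_prop : Continuous fun y : ℝ => d * (1 + c * y)).continuousAt.eventually_lt_const
      (by simpa)
  filter_upwards [h1.filter_mono nhdsWithin_le_nhds, h2.filter_mono nhdsWithin_le_nhds,
    self_mem_nhdsWithin] with y hpos hlt hy
  rw [← Real.le_log_iff_exp_le hpos]
  refine le_trans ?_ (Real.one_sub_inv_le_log_of_pos hpos)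
  have one_sub_inv_eq : 1 - (1 + c * y)⁻¹ = c * y / (1 + c * y) := by
    field_simp
    ring
  rw [one_sub_inv_eq, le_div_iff₀ hpos]
  nlinarith [Set.mem_Ici.1 hy]

lemma eventually_cosMajorized_rpow (r β γ : ℝ) {ε : ℝ} (hε : 0 < ε) :
    ∀ᶠ x : ℝ in 𝓝 0, CosMajorized (fun θ => (1 + (β * x * Real.cos θ + γ * x ^ 2)) ^ r)
      (Real.exp ((r * γ + r * (r - 1) * β ^ 2 / 4 + ε) * x ^ 2)) := by
  set ε' := ε / (β ^ 2 + 1) with hε'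
  have hβε : β ^ 2 * ε' ≤ ε := by
    rw [hε', ← mul_div_assoc, div_le_iff₀ (by positivity)]
    nlinarith
  set A := r * (r - 1) / 2 + ε' with hA
  obtain ⟨η, hη, taylor⟩ := Metric.eventually_nhds_iff.1
    (eventually_one_add_rpow_le r (show 0 < ε' by positivity))
  have hsmall : ∀ᶠ x : ℝ in 𝓝 0, |β| * |x| + |γ| * x ^ 2 < η :=
    (by fun_prop : Continuous fun x : ℝ => |β| * |x| + |γ| * x ^ 2).continuousAt.eventually_lt_const
      (by simpa)
  have hquartic : ∀ᶠ x : ℝ in 𝓝 0, A * γ ^ 2 * x ^ 2 < ε / 2 :=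
    (by fun_prop : Continuous fun x : ℝ => A * γ ^ 2 * x ^ 2).continuousAt.eventually_lt_const
      (by simpa)
  filter_upwards [hsmall, hquartic] with x hx hx4
  refine CosMajorized.mono (m := 1 + r * γ * x ^ 2 + A * (β ^ 2 * x ^ 2 / 2 + γ ^ 2 * x ^ 4))
    ⟨r * β * x + 2 * A * β * γ * x ^ 3, A * β ^ 2 * x ^ 2 / 2, fun θ => ?_⟩ le_rfl ?_
  · refine (taylor ?_).trans (le_of_eq ?_)
    · rw [Real.dist_0_eq_abs]
      calc
        _ ≤ |β| * |x| * |Real.cos θ| + |γ| * x ^ 2 :=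
          (abs_add_le _ _).trans_eq (by rw [abs_mul, abs_mul, abs_mul γ, abs_sq])
        _ ≤ |β| * |x| + |γ| * x ^ 2 := by
          gcongr ?_ + _
          exact mul_le_of_le_one_right (by positivity) (Real.abs_cos_le_one θ)
        _ < η := hx
    · rw [Real.cos_two_mul]
      ring
  · have hmean : r * γ * x ^ 2 + A * (β ^ 2 * x ^ 2 / 2 + γ ^ 2 * x ^ 4)
        ≤ (r * γ + r * (r - 1) * β ^ 2 / 4 + ε) * x ^ 2 := by
      have h2 := mul_le_mul_of_nonneg_right hβε (sq_nonneg x)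
      have h4 := mul_le_mul_of_nonneg_right hx4.le (sq_nonneg x)
      rw [hA] at h4 ⊢
      linarith
    linarith [Real.add_one_le_exp ((r * γ + r * (r - 1) * β ^ 2 / 4 + ε) * x ^ 2)]

/-! ### The local factors of the test function and of its dual -/

/-- The coefficients of the local factor `1 + (2/p) x z` of the test function, where `z = q^{-s}`;
only `k ≤ 1` is used. -/
def testCoeff (p x : ℝ) (k : ℕ) : ℝ := (2 / p * x) ^ k

/-- The coefficients of the local factor of the dual trigonometric polynomial, which agrees with
`|K|^{p-2} K` for `K = 1 + x e^{iθ}` to first order; the second-order terms make its modulus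
at most `1 + (p-1) x cos θ` up to `O(x³)`. -/
def dualCoeff (p x : ℝ) : ℤ → ℝ := quadCoeff (1 - x ^ 2 / 4) ((p - 1) * x) (x ^ 2 / 4) x

/-- The conjugate power `(1 + (p-1) x cos θ)^{p/(p-1)}` of the bound for the dual factor. At
`p = 1` the exponent is `1/0 = 0` and the value is `1`. -/
def dualMajorant (p x θ : ℝ) : ℝ := (1 + (p - 1) * x * Real.cos θ) ^ (p / (p - 1))

lemma eventually_cosMajorized_test {p : ℝ} (hp : 0 < p) {ε : ℝ} (hε : 0 < ε) :
    ∀ᶠ x : ℝ in 𝓝 0, CosMajorized (fun θ => ‖∑ k ∈ Finset.range (1 + 1),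
      (testCoeff p x k : ℂ) * meanExp (-1) θ ^ k‖ ^ p) (Real.exp ((1 + ε) * x ^ 2)) := by
  filter_upwards [eventually_cosMajorized_rpow (p / 2) (4 / p) (4 / p ^ 2) hε] with x hx
  refine hx.mono (fun θ => le_of_eq ?_) (le_of_eq ?_)
  · have norm_sq_eq : ‖1 + ((2 / p * x : ℝ) : ℂ) * meanExp (-1) θ‖ ^ 2
        = 1 + (4 / p * x * Real.cos θ + 4 / p ^ 2 * x ^ 2) := by
      rw [Complex.sq_norm, meanExp_eq_cos_add_sin, Complex.normSq_apply]
      simp only [neg_mul, one_mul, Real.cos_neg, Real.sin_neg, Complex.add_re, Complex.add_im,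
        Complex.one_re, Complex.one_im, Complex.re_ofReal_mul, Complex.im_ofReal_mul,
        Complex.ofReal_re, Complex.ofReal_im, Complex.I_re, Complex.I_im]
      linear_combination (2 / p * x) ^ 2 * Real.sin_sq_add_cos_sq θ
    simp only [Finset.sum_range_succ, Finset.sum_range_zero, testCoeff, pow_zero, pow_one, zero_add,
      Complex.ofReal_one, mul_one]
    rw [← norm_sq_eq, ← Real.rpow_natCast, ← Real.rpow_mul (norm_nonneg _),
      show ((2 : ℕ) : ℝ) * (p / 2) = p by push_cast; ring]
  · congr 2
    field_simp
    ring

lemma eventually_cosMajorized_dualMajorant {p : ℝ} (hp : 1 ≤ p) {ε : ℝ} (hε : 0 < ε) :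
    ∀ᶠ x : ℝ in 𝓝 0, CosMajorized (dualMajorant p x) (Real.exp ((p / 4 + ε) * x ^ 2)) := by
  filter_upwards [eventually_cosMajorized_rpow (p / (p - 1)) (p - 1) 0 hε] with x hx
  refine hx.mono (fun θ => by simp [dualMajorant]) ?_
  rcases hp.eq_or_lt with rfl | hp
  · gcongr
    norm_num
  · have : p - 1 ≠ 0 := by linarith
    refine le_of_eq ?_
    congr 2
    field_simp
    ring

lemma eventually_half_le_one_add_mul_cos (c : ℝ) :
    ∀ᶠ x : ℝ in 𝓝 0, ∀ θ, 1 / 2 ≤ 1 + c * x * Real.cos θ := by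
  have hsmall : ∀ᶠ x : ℝ in 𝓝 0, |c * x| < 1 / 2 :=
    (by fun_prop : Continuous fun x : ℝ => |c * x|).continuousAt.eventually_lt_const (by simp)
  filter_upwards [hsmall] with x hx θ
  have hcos : |c * x * Real.cos θ| ≤ |c * x| := by
    rw [abs_mul]
    exact mul_le_of_le_one_right (abs_nonneg _) (Real.abs_cos_le_one θ)
  linarith [(abs_le.1 hcos).1]

lemma dualMajorant_rpow {p x θ : ℝ} (hp : 1 ≤ p) (h : 0 ≤ 1 + (p - 1) * x * Real.cos θ) :
    dualMajorant p x θ ^ (1 - 1 / p) = 1 + (p - 1) * x * Real.cos θ := by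
  rcases hp.eq_or_lt with rfl | hp
  · simp
  · have : p - 1 ≠ 0 := by linarith
    have hexp : p / (p - 1) * (1 - 1 / p) = 1 := by field_simp
    rw [dualMajorant, ← Real.rpow_mul h, hexp, Real.rpow_one]

-- With `W = 1 + (p-1) x cos θ`, the sum is `W - x² sin² θ / 2 + i x sin θ`: in the square of the
-- modulus the terms of order `x²` cancel.
lemma normSq_sum_dualCoeff (p x θ : ℝ) :
    ‖∑ k ∈ Finset.Icc (-(2 : ℕ) : ℤ) (2 : ℕ), (dualCoeff p x k : ℂ) * meanExp k θ‖ ^ 2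
      = (1 + (p - 1) * x * Real.cos θ) ^ 2 - (p - 1) * Real.cos θ * Real.sin θ ^ 2 * x ^ 3
        + Real.sin θ ^ 4 / 4 * x ^ 4 := by
  have hsum := sum_quadCoeff_mul_meanExp (1 - x ^ 2 / 4) ((p - 1) * x) (x ^ 2 / 4) x 1 θ
  simp only [mul_one, one_mul] at hsum
  rw [dualCoeff, hsum, Complex.sq_norm, Complex.normSq_add_mul_I, Real.cos_two_mul]
  linear_combination (x ^ 2 * (1 + (p - 1) * x * Real.cos θ - x ^ 2 * Real.sin θ ^ 2 / 2)
    + x ^ 4 / 4 * (Real.sin θ ^ 2 + Real.cos θ ^ 2 - 1)) * Real.sin_sq_add_cos_sq θ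

lemma eventually_norm_sum_dualCoeff_le {p : ℝ} (hp : 1 ≤ p) {ε : ℝ} (hε : 0 < ε) :
    ∀ᶠ x : ℝ in 𝓝 0, ∀ θ,
      ‖∑ k ∈ Finset.Icc (-(2 : ℕ) : ℤ) (2 : ℕ), (dualCoeff p x k : ℂ) * meanExp k θ‖
        ≤ Real.exp (ε * x ^ 2) * dualMajorant p x θ ^ (1 - 1 / p) := by
  have hsmall : ∀ᶠ x : ℝ in 𝓝 0, (p - 1) * |x| + x ^ 2 / 4 < ε / 2 :=
    (by fun_prop : Continuous fun x : ℝ => (p - 1) * |x| + x ^ 2 / 4).continuousAt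
      |>.eventually_lt_const (by simpa)
  filter_upwards [hsmall, eventually_half_le_one_add_mul_cos (p - 1)] with x hx hW θ
  set W := 1 + (p - 1) * x * Real.cos θ with hWdef
  have hW0 : 1 / 2 ≤ W := hW θ
  rw [dualMajorant_rpow hp (by linarith)]
  have hsin : Real.sin θ ^ 2 ≤ 1 := Real.sin_sq_le_one θ
  have hcubic : -((p - 1) * Real.cos θ * Real.sin θ ^ 2 * x ^ 3) ≤ (p - 1) * |x| * x ^ 2 := by
    have hcos : |Real.cos θ| * Real.sin θ ^ 2 ≤ 1 :=
      mul_le_one₀ (Real.abs_cos_le_one θ) (sq_nonneg _) hsin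
    calc
      _ ≤ |(p - 1) * Real.cos θ * Real.sin θ ^ 2 * x ^ 3| := neg_le_abs _
      _ = (p - 1) * |x| * x ^ 2 * (|Real.cos θ| * Real.sin θ ^ 2) := by
        rw [abs_mul, abs_mul, abs_mul, abs_of_nonneg (sub_nonneg.2 hp), abs_sq, pow_succ' x 2,
          abs_mul, abs_sq]
        ring
      _ ≤ (p - 1) * |x| * x ^ 2 :=
        mul_le_of_le_one_right (mul_nonneg (mul_nonneg (sub_nonneg.2 hp) (abs_nonneg x))
          (sq_nonneg x)) hcos
  have hquartic : Real.sin θ ^ 4 / 4 * x ^ 4 ≤ x ^ 2 / 4 * x ^ 2 := by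
    have : Real.sin θ ^ 4 ≤ 1 := by nlinarith [sq_nonneg (Real.sin θ)]
    nlinarith [pow_nonneg (sq_nonneg x) 2]
  calc
    _ ≤ (1 + ε * x ^ 2) * W := by
      refine le_of_sq_le_sq ?_ (mul_nonneg (by positivity) (by linarith))
      rw [normSq_sum_dualCoeff, ← hWdef]
      have hε_gain : ε * x ^ 2 / 2 ≤ 2 * (ε * x ^ 2) * W ^ 2 := by
        have : 1 / 4 ≤ W ^ 2 := by nlinarith
        nlinarith [mul_nonneg hε.le (sq_nonneg x)]
      nlinarith [mul_le_mul_of_nonneg_right hx.le (sq_nonneg x), sq_nonneg (ε * x ^ 2 * W)]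
    _ ≤ Real.exp (ε * x ^ 2) * W := by
      gcongr
      linarith [Real.add_one_le_exp (ε * x ^ 2)]

lemma sum_testCoeff_mul_pow (p x : ℝ) :
    ∑ k ∈ Finset.range (1 + 1), testCoeff p x k * x ^ k = 1 + 2 / p * x ^ 2 := by
  simp only [Finset.sum_range_succ, Finset.sum_range_zero, testCoeff]
  ring

lemma testCoeff_nonneg {p x : ℝ} (hp : 0 ≤ p) (hx : 0 ≤ x) (k : ℕ) : 0 ≤ testCoeff p x k := by
  unfold testCoeff
  positivity

lemma sum_dualCoeff_mul_pow (p x : ℝ) :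
    ∑ k ∈ Finset.range (2 + 1), dualCoeff p x k * x ^ k
      = 1 + (p / 2 - 1 / 4) * x ^ 2 + x ^ 4 / 8 := by
  simp only [Finset.sum_range_succ, Finset.sum_range_zero, dualCoeff, quadCoeff, Nat.cast_zero,
    Nat.cast_one, Nat.cast_ofNat, one_ne_zero, OfNat.ofNat_ne_zero, OfNat.ofNat_ne_one,
    Int.reduceNeg, reduceCtorEq, if_true, if_false]
  ring

lemma dualCoeff_zero (p x : ℝ) : dualCoeff p x 0 = 1 - x ^ 2 / 4 := by
  simp [dualCoeff, quadCoeff]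

lemma dualCoeff_natCast_nonneg {p x : ℝ} (hp : 0 ≤ p) (hx : 0 ≤ x) (hx1 : x ≤ 1) (k : ℕ) :
    0 ≤ dualCoeff p x k := by
  have hk : (k : ℤ) ≠ -1 := by omega
  simp only [dualCoeff, quadCoeff, hk, if_false]
  split_ifs
  · nlinarith
  · nlinarith
  · positivity

/-- The local inequalities at a prime `q`, where `x` stands for `q^{-1/2-δ}`, with all constants
correct up to a factor `exp (ε x²)`. -/
structure FactorEstimates (p ε x : ℝ) : Prop where
  le_one : x ≤ 1
  cosMajorized_test : CosMajorized (fun θ => ‖∑ k ∈ Finset.range (1 + 1),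
    (testCoeff p x k : ℂ) * meanExp (-1) θ ^ k‖ ^ p) (Real.exp ((1 + ε) * x ^ 2))
  dualMajorant_nonneg : 0 ≤ dualMajorant p x
  cosMajorized_dualMajorant : CosMajorized (dualMajorant p x) (Real.exp ((p / 4 + ε) * x ^ 2))
  norm_sum_dualCoeff_le (θ : ℝ) :
    ‖∑ k ∈ Finset.Icc (-(2 : ℕ) : ℤ) (2 : ℕ), (dualCoeff p x k : ℂ) * meanExp k θ‖
      ≤ Real.exp (ε * x ^ 2) * dualMajorant p x θ ^ (1 - 1 / p)
  exp_le_test : Real.exp ((2 / p - ε) * x ^ 2) ≤ ∑ k ∈ Finset.range (1 + 1), testCoeff p x k * x ^ k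
  exp_le_dual : Real.exp ((p / 2 - 1 / 4 - ε) * x ^ 2)
    ≤ ∑ k ∈ Finset.range (2 + 1), dualCoeff p x k * x ^ k

lemma eventually_factorEstimates {p : ℝ} (hp : 1 ≤ p) {ε : ℝ} (hε : 0 < ε) :
    ∀ᶠ x : ℝ in 𝓝 0, FactorEstimates p ε x := by
  have tendsto_sq : Tendsto (fun x : ℝ => x ^ 2) (𝓝 0) (𝓝[≥] 0) :=
    tendsto_nhdsWithin_iff.2 ⟨by simpa using (continuous_pow 2).tendsto (0 : ℝ),
      Eventually.of_forall sq_nonneg⟩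
  have exp_le (c : ℝ) : ∀ᶠ x : ℝ in 𝓝 0, Real.exp ((c - ε) * x ^ 2) ≤ 1 + c * x ^ 2 :=
    tendsto_sq.eventually (eventually_exp_mul_le_one_add_mul (sub_lt_self c hε))
  filter_upwards [eventually_le_nhds zero_lt_one,
    eventually_cosMajorized_test (zero_lt_one.trans_le hp) hε,
    eventually_half_le_one_add_mul_cos (p - 1), eventually_cosMajorized_dualMajorant hp hε,
    eventually_norm_sum_dualCoeff_le hp hε, exp_le (2 / p), exp_le (p / 2 - 1 / 4)]
    with x hx htest hhalf hdual hnorm hexp_test hexp_dual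
  exact
    { le_one := hx
      cosMajorized_test := htest
      dualMajorant_nonneg := fun θ => Real.rpow_nonneg (one_half_pos.le.trans (hhalf θ)) _
      cosMajorized_dualMajorant := hdual
      norm_sum_dualCoeff_le := hnorm
      exp_le_test := hexp_test.trans_eq (sum_testCoeff_mul_pow p x).symm
      exp_le_dual := hexp_dual.trans <| by
        rw [sum_dualCoeff_mul_pow]
        exact le_add_of_nonneg_right (by positivity) }

/-! ### Dirichlet coefficients of the transform -/

lemma norm_dirEval_le {P : ℕ+ →₀ ℂ} {w : ℂ} (hw : 0 ≤ w.re) :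
    ‖dirEval P w‖ ≤ ∑ n ∈ P.support, ‖P n‖ := by
  refine (norm_sum_le _ _).trans (Finset.sum_le_sum fun n _ => ?_)
  rw [norm_mul, Complex.norm_natCast_cpow_of_pos n.pos]
  exact mul_le_of_le_one_right (norm_nonneg _)
    (Real.rpow_le_one_of_one_le_of_nonpos (by exact_mod_cast n.pos) (by simpa using hw))

lemma continuous_dirEval (P : ℕ+ →₀ ℂ) : Continuous (dirEval P) :=
  continuous_finsetSum _ fun _ _ =>
    continuous_const.mul (continuous_neg.const_cpow (Or.inl (by simp)))

lemma norm_dirEval_mul_cpow_le (P : ℕ+ →₀ ℂ) {n : ℕ} (hn : 2 ≤ n) {w : ℝ} (hw : 0 ≤ w) :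
    ‖dirEval P w * (n : ℂ) ^ (-(w : ℂ))‖
      ≤ (∑ n ∈ P.support, ‖P n‖) * Real.exp (-Real.log 2 * w) := by
  rw [norm_mul, Complex.norm_natCast_cpow_of_pos (by omega), Complex.neg_re, Complex.ofReal_re,
    neg_mul, ← mul_neg, ← Real.rpow_def_of_pos two_pos]
  gcongr ?_ * ?_
  · exact norm_dirEval_le (by simpa)
  · exact Real.rpow_le_rpow_of_nonpos two_pos (by exact_mod_cast hn) (neg_nonpos.2 hw)

lemma integrableOn_exp_neg_log_two_mul (C : ℝ) :
    IntegrableOn (fun w => C * Real.exp (-Real.log 2 * w)) (Set.Ioi (1 / 2)) :=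
  (exp_neg_integrableOn_Ioi (1 / 2) (Real.log_pos one_lt_two)).const_mul C

lemma integrableOn_dirEval_mul_cpow (P : ℕ+ →₀ ℂ) {n : ℕ} (hn : 2 ≤ n) :
    IntegrableOn (fun w : ℝ => dirEval P w * (n : ℂ) ^ (-(w : ℂ))) (Set.Ioi (1 / 2)) := by
  have hcont : Continuous fun w : ℝ => dirEval P w * (n : ℂ) ^ (-(w : ℂ)) :=
    ((continuous_dirEval P).comp Complex.continuous_ofReal).mul
      (Complex.continuous_ofReal.neg.const_cpow (Or.inl (by norm_cast; omega)))
  refine (integrableOn_exp_neg_log_two_mul (∑ n ∈ P.support, ‖P n‖)).mono'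
    hcont.aestronglyMeasurable ?_
  filter_upwards [self_mem_ae_restrict measurableSet_Ioi] with w hw
  exact norm_dirEval_mul_cpow_le P hn (one_half_pos.trans hw).le

lemma exists_integral_norm_dirEval_mul_cpow_le (P : ℕ+ →₀ ℂ) :
    ∃ C, 0 ≤ C ∧ ∀ n : ℕ, 2 ≤ n →
      ∫ w in Set.Ioi (1 / 2 : ℝ), ‖dirEval P w * (n : ℂ) ^ (-(w : ℂ))‖ ≤ C :=
  ⟨∫ w in Set.Ioi (1 / 2 : ℝ), (∑ n ∈ P.support, ‖P n‖) * Real.exp (-Real.log 2 * w),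
    integral_nonneg fun w => by positivity,
    fun _ hn => setIntegral_mono_on (integrableOn_dirEval_mul_cpow P hn).norm
      (integrableOn_exp_neg_log_two_mul _) measurableSet_Ioi
      fun _ hw => norm_dirEval_mul_cpow_le P hn (one_half_pos.trans hw).le⟩

lemma riemannZeta_sub_one {s : ℂ} (hs : 1 < s.re) :
    riemannZeta s - 1 = ∑' n : ℕ, ((n + 2 : ℕ) : ℂ) ^ (-s) := by
  have hsum : Summable fun n : ℕ => 1 / ((n : ℂ) + 1) ^ s := by
    simpa using (summable_nat_add_iff 1).2 (Complex.summable_one_div_nat_cpow.2 hs)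
  rw [zeta_eq_tsum_one_div_nat_add_one_cpow hs, hsum.tsum_eq_zero_add]
  simp only [Nat.cast_zero, zero_add, Complex.one_cpow, div_one, add_sub_cancel_left]
  refine tsum_congr fun n => ?_
  rw [Complex.cpow_neg, one_div, Nat.cast_succ, add_assoc, one_add_one_eq_two]
  push_cast
  ring_nf

/-- The coefficient of `n^{-s}` in the Dirichlet series of the transform of `P`. There is no
constant term, since `ζ - 1` has none. -/
def hilbertCoeff (P : ℕ+ →₀ ℂ) (n : ℕ) : ℂ :=
  if 2 ≤ n then ∫ w in Set.Ioi (1 / 2 : ℝ), dirEval P w * (n : ℂ) ^ (-(w : ℂ)) else 0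

lemma exists_norm_hilbertCoeff_le (P : ℕ+ →₀ ℂ) : ∃ C, ∀ n, ‖hilbertCoeff P n‖ ≤ C := by
  obtain ⟨C, hC0, hC⟩ := exists_integral_norm_dirEval_mul_cpow_le P
  refine ⟨C, fun n => ?_⟩
  unfold hilbertCoeff
  split_ifs with hn
  · exact (norm_integral_le_integral_norm _).trans (hC n hn)
  · simpa

lemma lseriesHasSum_hilbertCoeff (P : ℕ+ →₀ ℂ) {s : ℂ} (hs : 1 < s.re) :
    LSeriesHasSum (hilbertCoeff P) s (mulHilbert (dirEval P) s) := by
  set f : ℕ → ℝ → ℂ := fun n w =>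
    dirEval P w * ((n + 2 : ℕ) : ℂ) ^ (-(w : ℂ)) * ((n + 2 : ℕ) : ℂ) ^ (-s) with hf
  have term_eq (n : ℕ) :
      LSeries.term (hilbertCoeff P) s (n + 2) = ∫ w in Set.Ioi (1 / 2 : ℝ), f n w := by
    rw [LSeries.term_of_ne_zero (by omega), hilbertCoeff, if_pos (by omega), hf,
      integral_mul_const, Complex.cpow_neg, div_eq_mul_inv]
  have mulHilbert_eq : mulHilbert (dirEval P) s = ∫ w in Set.Ioi (1 / 2 : ℝ), ∑' n, f n w := by
    refine setIntegral_congr_fun measurableSet_Ioi fun w (hw : 1 / 2 < w) => ?_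
    rw [riemannZeta_sub_one (by simp; linarith), ← tsum_mul_left]
    refine tsum_congr fun n => ?_
    simp only [hf]
    rw [mul_assoc, ← Complex.cpow_add _ _ (Nat.cast_ne_zero.2 (by omega)), neg_add]
  have summable_integral : Summable fun n => ∫ w in Set.Ioi (1 / 2 : ℝ), ‖f n w‖ := by
    obtain ⟨C, -, hC⟩ := exists_integral_norm_dirEval_mul_cpow_le P
    have hsum : Summable fun n : ℕ => C * ((n + 2 : ℕ) : ℝ) ^ (-s.re) :=
      ((summable_nat_add_iff 2).2 (Real.summable_nat_rpow.2 (by linarith))).mul_left _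
    refine hsum.of_nonneg_of_le (fun n => integral_nonneg fun w => norm_nonneg _) fun n => ?_
    simp_rw [hf, norm_mul _ (((n + 2 : ℕ) : ℂ) ^ (-s))]
    rw [integral_mul_const, Complex.norm_natCast_cpow_of_pos (by omega), Complex.neg_re]
    gcongr
    exact hC _ (by omega)
  have hasSum : HasSum (fun n => ∫ w in Set.Ioi (1 / 2 : ℝ), f n w) (mulHilbert (dirEval P) s) :=
    mulHilbert_eq ▸ hasSum_integral_of_summable_integral_norm
      (fun n => (integrableOn_dirEval_mul_cpow P (by omega)).mul_const _) summable_integral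
  rw [LSeriesHasSum, ← hasSum_nat_add_iff' 2]
  simp only [term_eq]
  simpa [Finset.sum_range_succ, LSeries.term_def, hilbertCoeff] using hasSum

lemma DirHardy.norm_coeff_le {p : ℝ} [hp : Fact (1 ≤ p)] (n : ℕ+) (F : DirHardy p) :
    ‖DirHardy.coeff n F‖ ≤ ‖F‖ := by
  induction F using UniformSpace.Completion.induction_on with
  | hp => exact isClosed_le (by fun_prop) (by fun_prop)
  | ih P =>
    rw [DirHardy.coeff_coe, UniformSpace.Completion.norm_coe]
    exact _root_.norm_coeff_le p hp.out P n

/-- The Dirichlet coefficients of `F` as an arithmetic function, with the value `0` at `0`. -/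
def DirHardy.coeffSeq {p : ℝ} [Fact (1 ≤ p)] (F : DirHardy p) (n : ℕ) : ℂ :=
  if h : 0 < n then DirHardy.coeff ⟨n, h⟩ F else 0

lemma DirHardy.coeffSeq_coe {p : ℝ} [Fact (1 ≤ p)] (F : DirHardy p) (n : ℕ+) :
    DirHardy.coeffSeq F n = DirHardy.coeff n F :=
  dif_pos n.pos

lemma DirHardy.toFun_eq_LSeries {p : ℝ} [Fact (1 ≤ p)] (F : DirHardy p) (s : ℂ) :
    DirHardy.toFun F s = LSeries (DirHardy.coeffSeq F) s := by
  rw [LSeries, ← PNat.coe_injective.tsum_eq, DirHardy.toFun]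
  · refine tsum_congr fun n => ?_
    rw [LSeries.term_of_ne_zero n.ne_zero, DirHardy.coeffSeq_coe, Complex.cpow_neg, div_eq_mul_inv]
  · intro n hn
    have hn0 : n ≠ 0 := by
      rintro rfl
      simp at hn
    exact ⟨⟨n, Nat.pos_of_ne_zero hn0⟩, rfl⟩

lemma abscissaOfAbsConv_lt_top_of_norm_le {f : ℕ → ℂ} {C : ℝ} (h : ∀ n, ‖f n‖ ≤ C) :
    LSeries.abscissaOfAbsConv f < ⊤ :=
  (LSeries.abscissaOfAbsConv_le_of_le_const ⟨C, fun n _ => h n⟩).trans_lt (by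
    exact_mod_cast EReal.coe_lt_top 1)

lemma DirHardy.coeff_eq_hilbertCoeff {p : ℝ} [Fact (1 ≤ p)] {F : DirHardy p} {P : ℕ+ →₀ ℂ}
    (h : ∀ s : ℂ, 1 / 2 < s.re → DirHardy.toFun F s = mulHilbert (dirEval P) s) (n : ℕ+) :
    DirHardy.coeff n F = hilbertCoeff P n := by
  obtain ⟨C, hC⟩ := exists_norm_hilbertCoeff_le P
  have norm_coeffSeq_le (n : ℕ) : ‖DirHardy.coeffSeq F n‖ ≤ ‖F‖ := by
    unfold DirHardy.coeffSeq
    split_ifs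
    · exact DirHardy.norm_coeff_le _ F
    · simp
  have eventually_eq : (fun x : ℝ => LSeries (DirHardy.coeffSeq F) x)
      =ᶠ[atTop] fun x => LSeries (hilbertCoeff P) x := by
    filter_upwards [eventually_gt_atTop 1] with x hx
    rw [← DirHardy.toFun_eq_LSeries, h x (one_half_lt_one.trans hx),
      (lseriesHasSum_hilbertCoeff P (s := x) hx).LSeries_eq]
  rw [← DirHardy.coeffSeq_coe]
  exact LSeries.eq_of_LSeries_eventually_eq (abscissaOfAbsConv_lt_top_of_norm_le norm_coeffSeq_le)
    (abscissaOfAbsConv_lt_top_of_norm_le hC) eventually_eq n.ne_zero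

lemma two_le_of_mem_support {B : ℕ+ →₀ ℂ} (hB : B 1 = 0) {n : ℕ+} (hn : n ∈ B.support) :
    2 ≤ (n : ℕ) :=
  Nat.lt_of_le_of_ne n.pos fun h => by
    obtain rfl : n = 1 := PNat.eq h.symm
    exact Finsupp.mem_support_iff.1 hn hB

lemma sum_mul_hilbertCoeff (A B : ℕ+ →₀ ℂ) :
    (B.sum fun n b => b * hilbertCoeff A n)
      = ∫ w in Set.Ioi (1 / 2 : ℝ), dirEval A w * dirEval (B.erase 1) w := by
  have two_le {n : ℕ+} : n ∈ (B.erase 1).support → 2 ≤ (n : ℕ) :=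
    two_le_of_mem_support Finsupp.erase_same
  calc
    _ = (B.erase 1).sum fun n b => b * hilbertCoeff A n := by
      rw [← Finsupp.add_sum_erase' B 1 _ (by simp)]
      simp [hilbertCoeff]
    _ = ∑ n ∈ (B.erase 1).support, ∫ w in Set.Ioi (1 / 2 : ℝ),
          B.erase 1 n * (dirEval A w * ((n : ℕ) : ℂ) ^ (-(w : ℂ))) :=
      Finset.sum_congr rfl fun n hn => by
        simp only [integral_const_mul, hilbertCoeff, two_le hn, if_true]
    _ = _ := by
      rw [← integral_finsetSum _ fun n hn =>
        (integrableOn_dirEval_mul_cpow A (two_le hn)).const_mul _]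
      simp only [dirEval, Finsupp.sum, Finset.mul_sum, mul_left_comm]

/-! ### The bilinear form of the transform -/

lemma dirEval_erase_one (P : ℕ+ →₀ ℂ) (s : ℂ) : dirEval (P.erase 1) s = dirEval P s - P 1 := by
  rw [dirEval, dirEval, ← Finsupp.add_sum_erase' P 1 _ (by simp)]
  simp

lemma dirNorm_single_one_le {p : ℝ} (hp : 0 < p) : dirNorm p (Finsupp.single 1 1) ≤ 1 := by
  have hmean : HasMean (fun _ => ((1 : ℝ) : ℂ)) (1 : ℝ) := by
    simpa [HasMean, meanExp_zero] using tendsto_mean_meanExp 0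
  simpa using dirNorm_le_of_rpow_le hp (Finsupp.single 1 1) continuous_const
    (fun t => by simp [dirEval_single]) hmean

lemma dirNorm_erase_one_le {p : ℝ} (hp : 1 ≤ p) (P : ℕ+ →₀ ℂ) :
    dirNorm p (P.erase 1) ≤ 2 * dirNorm p P := by
  have erase_eq : P.erase 1 = P + (-P 1) • Finsupp.single 1 1 := by
    rw [Finsupp.erase_eq_sub_single, Finsupp.smul_single_one, Finsupp.single_neg, sub_eq_add_neg]
  calc
    _ ≤ dirNorm p P + ‖P 1‖ * dirNorm p (Finsupp.single 1 1) := by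
      rw [erase_eq, ← norm_neg, ← dirNorm_smul p hp]
      exact dirNorm_add_le p hp _ _
    _ ≤ dirNorm p P + dirNorm p P * 1 := by
      gcongr
      · exact dirNorm_nonneg p (zero_le_one.trans hp) _
      · exact dirNorm_nonneg p (zero_le_one.trans hp) _
      · exact norm_coeff_le p hp P 1
      · exact dirNorm_single_one_le (zero_lt_one.trans_le hp)
    _ = 2 * dirNorm p P := by ring

section

open scoped ComplexOrder

lemma ofReal_norm_dirEval {P : ℕ+ →₀ ℂ} (hP : ∀ n, 0 ≤ P n) (w : ℝ) :
    (‖dirEval P w‖ : ℂ) = dirEval P w :=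
  Complex.norm_of_nonneg' <| Finset.sum_nonneg fun n _ => mul_nonneg (hP n) <| by
    rw [← Complex.ofReal_natCast, ← Complex.ofReal_neg, ← Complex.ofReal_cpow (Nat.cast_nonneg _)]
    exact_mod_cast Real.rpow_nonneg (Nat.cast_nonneg _) _

lemma antitone_norm_dirEval {P : ℕ+ →₀ ℂ} (hP : ∀ n, 0 ≤ P n) :
    Antitone fun w : ℝ => ‖dirEval P w‖ := by
  have norm_eq (w : ℝ) : ‖dirEval P w‖ = ∑ n ∈ P.support, ‖P n‖ * ((n : ℕ) : ℝ) ^ (-w) := by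
    rw [← Complex.ofReal_inj, ofReal_norm_dirEval hP, dirEval, Finsupp.sum, Complex.ofReal_sum]
    refine Finset.sum_congr rfl fun n _ => ?_
    rw [Complex.ofReal_mul, Complex.norm_of_nonneg' (hP n),
      Complex.ofReal_cpow (Nat.cast_nonneg _), Complex.ofReal_natCast, Complex.ofReal_neg]
  intro w w' hw
  simp only [norm_eq]
  gcongr
  exact_mod_cast n.pos

lemma mul_le_setIntegral_Ioi {h : ℝ → ℝ} (h0 : 0 ≤ h) (hh : Antitone h) {a δ : ℝ} (hδ : 0 ≤ δ)
    (hint : IntegrableOn h (Set.Ioi a)) : δ * h (a + δ) ≤ ∫ w in Set.Ioi a, h w :=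
  calc
    _ = ∫ _ in Set.Ioc a (a + δ), h (a + δ) := by
      rw [setIntegral_const, Measure.real, Real.volume_Ioc, add_sub_cancel_left,
        ENNReal.toReal_ofReal hδ, smul_eq_mul]
    _ ≤ ∫ w in Set.Ioc a (a + δ), h w :=
      setIntegral_mono_on (integrableOn_const (by simp)) (hint.mono_set Set.Ioc_subset_Ioi_self)
        measurableSet_Ioc fun w hw => hh hw.2
    _ ≤ _ := setIntegral_mono_set hint (Eventually.of_forall h0)
      Set.Ioc_subset_Ioi_self.eventuallyLE

lemma integrableOn_dirEval_mul_dirEval (A : ℕ+ →₀ ℂ) {B : ℕ+ →₀ ℂ} (hB : B 1 = 0) :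
    IntegrableOn (fun w : ℝ => dirEval A w * dirEval B w) (Set.Ioi (1 / 2)) := by
  change IntegrableOn
    (fun w : ℝ => dirEval A w * ∑ n ∈ B.support, B n * ((n : ℕ) : ℂ) ^ (-(w : ℂ))) _
  simp only [Finset.mul_sum, mul_left_comm _ (B _)]
  exact integrable_finsetSum _ fun n hn =>
    (integrableOn_dirEval_mul_cpow A (two_le_of_mem_support hB hn)).const_mul _

lemma mul_norm_dirEval_mul_le_norm_integral {A B : ℕ+ →₀ ℂ} (hA : ∀ n, 0 ≤ A n)
    (hB : ∀ n, 0 ≤ B n) (hB1 : B 1 = 0) {δ : ℝ} (hδ : 0 ≤ δ) :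
    δ * (‖dirEval A (1 / 2 + δ : ℝ)‖ * ‖dirEval B (1 / 2 + δ : ℝ)‖)
      ≤ ‖∫ w in Set.Ioi (1 / 2 : ℝ), dirEval A w * dirEval B w‖ := by
  have integral_eq : ∫ w in Set.Ioi (1 / 2 : ℝ), dirEval A w * dirEval B w
      = ((∫ w in Set.Ioi (1 / 2 : ℝ), ‖dirEval A w‖ * ‖dirEval B w‖ : ℝ) : ℂ) := by
    rw [← integral_complex_ofReal]
    simp only [Complex.ofReal_mul, ofReal_norm_dirEval hA, ofReal_norm_dirEval hB]
  rw [integral_eq, Complex.norm_real]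
  refine le_trans (mul_le_setIntegral_Ioi (h := fun w => ‖dirEval A w‖ * ‖dirEval B w‖)
    (fun w => by positivity) (fun w w' hw => ?_) hδ ?_) (Real.le_norm_self _)
  · exact mul_le_mul (antitone_norm_dirEval hA hw) (antitone_norm_dirEval hB hw)
      (norm_nonneg _) (norm_nonneg _)
  · simp only [← norm_mul]
    exact (integrableOn_dirEval_mul_dirEval A hB1).norm

lemma eulerPoly_nonneg {ι : Type*} [Fintype ι] [DecidableEq ι] (q : ι ↪ Nat.Primes) (d : ℕ)
    {c : ι → ℕ → ℂ} (hc : ∀ i k, 0 ≤ c i k) (n : ℕ+) : 0 ≤ eulerPoly q d c n := by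
  rw [eulerPoly_apply]
  refine Finset.sum_nonneg fun k _ => ?_
  split_ifs
  · exact Finset.prod_nonneg fun i _ => hc i _
  · exact le_rfl

/-- The operator `T` is a bounded extension of the transform from the Dirichlet polynomials to
the whole of `H^p_0`. -/
def ExtendsMulHilbert {p : ℝ} [Fact (1 ≤ p)] (T : DirHardyZero p →L[ℂ] DirHardyZero p) : Prop :=
  ∀ (P : DirPoly p) (hP : (P : DirHardy p) ∈ DirHardyZero p) (s : ℂ), 1 / 2 < s.re →
    DirHardy.toFun (T ⟨(P : DirHardy p), hP⟩ : DirHardy p) s = mulHilbert P.eval s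

lemma ExtendsMulHilbert.mul_norm_dirEval_mul_le {p : ℝ} [hp : Fact (1 ≤ p)]
    {T : DirHardyZero p →L[ℂ] DirHardyZero p} (hT : ExtendsMulHilbert T) {A B : ℕ+ →₀ ℂ}
    (hA : ∀ n, 0 ≤ A n) (hB : ∀ n, 0 ≤ B n) {D : ℝ} (hD : 0 ≤ D)
    (hBD : ∀ F : DirHardy p, ‖B.sum fun n b => b * DirHardy.coeff n F‖ ≤ D * ‖F‖)
    {δ : ℝ} (hδ : 0 ≤ δ) :
    δ * (‖dirEval (A.erase 1) (1 / 2 + δ : ℝ)‖ * ‖dirEval (B.erase 1) (1 / 2 + δ : ℝ)‖)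
      ≤ D * (‖T‖ * (2 * dirNorm p A)) := by
  have erase_nonneg {P : ℕ+ →₀ ℂ} (hP : ∀ n, 0 ≤ P n) (n : ℕ+) : 0 ≤ P.erase 1 n := by
    rw [Finsupp.erase_apply]
    split_ifs
    exacts [le_rfl, hP n]
  let P : DirPoly p := (DirPoly.coeffs p).symm (A.erase 1)
  have hP : (P : DirHardy p) ∈ DirHardyZero p :=
    (DirHardy.coeff_coe 1 P).trans Finsupp.erase_same
  have norm_eq : ‖(⟨(P : DirHardy p), hP⟩ : DirHardyZero p)‖ = dirNorm p (A.erase 1) :=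
    UniformSpace.Completion.norm_coe P
  calc
    _ ≤ ‖∫ w in Set.Ioi (1 / 2 : ℝ), dirEval (A.erase 1) w * dirEval (B.erase 1) w‖ :=
      mul_norm_dirEval_mul_le_norm_integral (erase_nonneg hA) (erase_nonneg hB)
        Finsupp.erase_same hδ
    _ = ‖B.sum fun n b => b * DirHardy.coeff n (T ⟨P, hP⟩ : DirHardy p)‖ := by
      rw [← sum_mul_hilbertCoeff]
      simp only [DirHardy.coeff_eq_hilbertCoeff (hT P hP)]
      rfl
    _ ≤ D * (‖T‖ * dirNorm p (A.erase 1)) := by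
      refine (hBD _).trans (mul_le_mul_of_nonneg_left ?_ hD)
      exact norm_eq ▸ T.le_opNorm _
    _ ≤ _ := by
      gcongr
      exact dirNorm_erase_one_le hp.out A

end

lemma prod_sum_sub_one_le_norm_dirEval_erase {ι : Type*} [Fintype ι] [DecidableEq ι]
    (q : ι ↪ Nat.Primes) (d : ℕ) {c : ι → ℕ → ℝ} (hc0 : ∀ i, 0 ≤ c i 0) (hc1 : ∀ i, c i 0 ≤ 1)
    (w : ℝ) : ∏ i, ∑ k ∈ Finset.range (d + 1), c i k * ((q i : ℝ) ^ (-w)) ^ k - 1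
      ≤ ‖dirEval ((eulerPoly q d fun i k => (c i k : ℂ)).erase 1) w‖ := by
  have value_eq : dirEval ((eulerPoly q d fun i k => (c i k : ℂ)).erase 1) w
      = ((∏ i, ∑ k ∈ Finset.range (d + 1), c i k * ((q i : ℝ) ^ (-w)) ^ k
        - ∏ i, c i 0 : ℝ) : ℂ) := by
    rw [dirEval_erase_one, dirEval_eulerPoly, eulerPoly_apply_one]
    push_cast [Complex.ofReal_cpow (Nat.cast_nonneg _)]
    rfl
  rw [value_eq, Complex.norm_real]
  refine le_trans ?_ (Real.le_norm_self _)
  gcongr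
  exact Finset.prod_le_one (fun i _ => hc0 i) fun i _ => hc1 i

/-! ### Sums over primes -/

lemma inv_one_sub_le_exp {t : ℝ} (ht : t ≤ 1 / 2) :
    (1 - t)⁻¹ ≤ Real.exp (t + 2 * t ^ 2) := by
  refine le_trans ?_ (Real.add_one_le_exp _)
  rw [inv_le_iff_one_le_mul₀ (by linarith)]
  nlinarith [mul_nonneg (sq_nonneg t) (by linarith : 0 ≤ 1 - 2 * t)]

lemma prod_norm_eulerFactor_le_exp (F : Finset Nat.Primes) {s : ℝ} (hs : 1 ≤ s) :
    ∏ q ∈ F, ‖(1 - (q : ℂ) ^ (-(s : ℂ)))⁻¹‖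
      ≤ Real.exp (∑ q ∈ F, (q : ℝ) ^ (-s) + 2 * ∑' q : Nat.Primes, (q : ℝ) ^ (-2 : ℝ)) := by
  have rpow_neg_le_half (q : Nat.Primes) : (q : ℝ) ^ (-s) ≤ 1 / 2 :=
    calc
      _ ≤ (q : ℝ) ^ (-1 : ℝ) :=
        Real.rpow_le_rpow_of_exponent_le (by exact_mod_cast q.2.one_le) (by linarith)
      _ ≤ 1 / 2 := by
        rw [Real.rpow_neg_one, one_div]
        exact inv_anti₀ two_pos (by exact_mod_cast q.2.two_le)
  have norm_eq (q : Nat.Primes) : ‖(1 - (q : ℂ) ^ (-(s : ℂ)))⁻¹‖ = (1 - (q : ℝ) ^ (-s))⁻¹ := by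
    have : (1 - (q : ℂ) ^ (-(s : ℂ)))⁻¹ = (((1 - (q : ℝ) ^ (-s))⁻¹ : ℝ) : ℂ) := by
      push_cast [Complex.ofReal_cpow (Nat.cast_nonneg _)]
      rfl
    rw [this, Complex.norm_of_nonneg (inv_nonneg.2 (by linarith [rpow_neg_le_half q]))]
  calc
    _ ≤ ∏ q ∈ F, Real.exp ((q : ℝ) ^ (-s) + 2 * ((q : ℝ) ^ (-s)) ^ 2) := by
      refine Finset.prod_le_prod (fun _ _ => norm_nonneg _) fun q _ => ?_
      rw [norm_eq]
      exact inv_one_sub_le_exp (rpow_neg_le_half q)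
    _ = Real.exp (∑ q ∈ F, (q : ℝ) ^ (-s) + 2 * ∑ q ∈ F, ((q : ℝ) ^ (-s)) ^ 2) := by
      rw [← Real.exp_sum, Finset.sum_add_distrib, Finset.mul_sum]
    _ ≤ _ := by
      gcongr
      refine (Finset.sum_le_sum fun q _ => ?_).trans
        ((Nat.Primes.summable_rpow.2 (by norm_num)).sum_le_tsum F fun q _ => by positivity)
      rw [← Real.rpow_mul_natCast (Nat.cast_nonneg _)]
      exact Real.rpow_le_rpow_of_exponent_le (by exact_mod_cast q.2.one_le) (by push_cast; linarith)

lemma eventually_half_div_le_norm_riemannZeta :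
    ∀ᶠ s : ℝ in 𝓝[>] 1, 1 / 2 / (s - 1) ≤ ‖riemannZeta s‖ := by
  have tendsto_ofReal : Tendsto (fun s : ℝ => (s : ℂ)) (𝓝[>] 1) (𝓝[≠] 1) :=
    tendsto_nhdsWithin_iff.2 ⟨(Complex.continuous_ofReal.tendsto' 1 1 rfl).mono_left
      nhdsWithin_le_nhds, by
        filter_upwards [self_mem_nhdsWithin] with s hs
        exact Complex.ofReal_ne_one.2 (Set.mem_Ioi.1 hs).ne'⟩
  have tendsto_norm := (riemannZeta_residue_one.comp tendsto_ofReal).norm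
  rw [norm_one] at tendsto_norm
  filter_upwards [tendsto_norm.eventually_const_lt one_half_lt_one, self_mem_nhdsWithin]
    with s hlt hs
  have hs0 : 0 < s - 1 := sub_pos.2 hs
  rw [div_le_iff₀' hs0]
  refine hlt.le.trans_eq ?_
  rw [Function.comp_apply, norm_mul, ← Complex.ofReal_one, ← Complex.ofReal_sub,
    Complex.norm_of_nonneg hs0.le]

lemma exists_div_le_exp_sum_primes {a : Nat.Primes → Prop} (ha : ∀ᶠ q in cofinite, a q) :
    ∃ c > 0, ∀ᶠ s : ℝ in 𝓝[>] 1, ∃ F : Finset Nat.Primes, (∀ q ∈ F, a q) ∧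
      c / (s - 1) ≤ Real.exp (∑ q ∈ F, (q : ℝ) ^ (-s)) := by
  classical
  set Y : Finset Nat.Primes := (eventually_cofinite.1 ha).toFinset with hY
  set C : ℝ := Y.card + 2 * ∑' q : Nat.Primes, (q : ℝ) ^ (-2 : ℝ)
  refine ⟨Real.exp (-C) / 4, by positivity, ?_⟩
  filter_upwards [eventually_half_div_le_norm_riemannZeta, self_mem_nhdsWithin] with s hζ hs
  have hs : 1 < s := hs
  have hζ_pos : 0 < ‖riemannZeta s‖ :=
    (div_pos one_half_pos (sub_pos.2 hs)).trans_le hζ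
  have hprod := (riemannZeta_eulerProduct_hasProd (s := s) (by simpa)).norm
  obtain ⟨F, hF⟩ := (hprod.eventually_const_lt (half_lt_self hζ_pos)).exists
  refine ⟨F \ Y, fun q hq => by_contra fun h => ?_, ?_⟩
  · exact (Finset.mem_sdiff.1 hq).2 (by simpa [hY] using h)
  have sum_le : ∑ q ∈ F, (q : ℝ) ^ (-s) ≤ ∑ q ∈ F \ Y, (q : ℝ) ^ (-s) + Y.card := by
    have sum_inter_le : ∑ q ∈ F ∩ Y, (q : ℝ) ^ (-s) ≤ Y.card :=
      calc
        _ ≤ ∑ _q ∈ F ∩ Y, (1 : ℝ) := Finset.sum_le_sum fun q _ =>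
          Real.rpow_le_one_of_one_le_of_nonpos (by exact_mod_cast q.2.one_le) (by linarith)
        _ ≤ Y.card := by
          rw [Finset.sum_const, nsmul_one]
          exact_mod_cast Finset.card_le_card Finset.inter_subset_right
    linarith [Finset.sum_inter_add_sum_sdiff F Y fun q => (q : ℝ) ^ (-s)]
  calc
    _ = Real.exp (-C) * (1 / 2 / (s - 1) / 2) := by ring
    _ ≤ Real.exp (-C) * Real.exp (∑ q ∈ F \ Y, (q : ℝ) ^ (-s) + C) := by
      gcongr
      refine (div_le_div_of_nonneg_right hζ two_pos.le).trans (hF.le.trans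
        ((prod_norm_eulerFactor_le_exp F hs.le).trans (Real.exp_le_exp.2 ?_)))
      linarith
    _ = _ := by
      rw [← Real.exp_add]
      ring_nf

lemma tendsto_rpow_neg_half_primes :
    Tendsto (fun q : Nat.Primes => (q : ℝ) ^ (-(1 / 2) : ℝ)) cofinite (𝓝 0) :=
  ((tendsto_rpow_neg_atTop one_half_pos).comp tendsto_natCast_atTop_atTop).comp
    (Nat.cofinite_eq_atTop ▸ Nat.Primes.coe_nat_injective.tendsto_cofinite)

lemma eventually_primes_rpow_neg {a : ℝ → Prop} (ha : ∀ᶠ x in 𝓝 0, a x) :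
    ∀ᶠ q : Nat.Primes in cofinite, ∀ σ : ℝ, 1 / 2 ≤ σ → a ((q : ℝ) ^ (-σ)) := by
  obtain ⟨r, hr, hball⟩ := Metric.eventually_nhds_iff.1 ha
  filter_upwards [tendsto_rpow_neg_half_primes.eventually_lt_const hr] with q hq σ hσ
  refine hball ?_
  rw [Real.dist_0_eq_abs, abs_of_nonneg (by positivity)]
  exact (Real.rpow_le_rpow_of_exponent_le (by exact_mod_cast q.2.one_le) (by linarith)).trans_lt hq

/-! ### Comparison of the growth rates -/

lemma exists_primes_factorEstimates {p : ℝ} (hp : 1 ≤ p) {ε : ℝ} (hε : 0 < ε) :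
    ∃ c > 0, ∀ M : ℝ, ∃ δ > 0, ∃ F : Finset Nat.Primes,
      (∀ q ∈ F, FactorEstimates p ε ((q : ℝ) ^ (-(1 / 2 + δ)))) ∧
      M ≤ ∑ q ∈ F, ((q : ℝ) ^ (-(1 / 2 + δ))) ^ 2 ∧
      c ≤ δ * Real.exp (∑ q ∈ F, ((q : ℝ) ^ (-(1 / 2 + δ))) ^ 2) := by
  obtain ⟨c, hc, hprimes⟩ :=
    exists_div_le_exp_sum_primes (eventually_primes_rpow_neg (eventually_factorEstimates hp hε))
  refine ⟨c / 2, half_pos hc, fun M => ?_⟩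
  have tendsto_sub : Tendsto (fun s : ℝ => s - 1) (𝓝[>] 1) (𝓝[>] 0) :=
    tendsto_nhdsWithin_iff.2 ⟨((continuous_sub_right 1).tendsto' 1 0 (sub_self 1)).mono_left
      nhdsWithin_le_nhds, by
        filter_upwards [self_mem_nhdsWithin] with s hs using sub_pos.2 (Set.mem_Ioi.1 hs)⟩
  have tendsto_div : Tendsto (fun s : ℝ => c / (s - 1)) (𝓝[>] 1) atTop :=
    (tendsto_inv_nhdsGT_zero.comp tendsto_sub).const_mul_atTop hc
  obtain ⟨s, ⟨F, hF, hcF⟩, hM, hs⟩ := (hprimes.and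
    ((tendsto_div.eventually_ge_atTop (Real.exp M)).and self_mem_nhdsWithin)).exists
  have hs0 : 0 < s - 1 := sub_pos.2 (Set.mem_Ioi.1 hs)
  have sq_eq (q : Nat.Primes) : ((q : ℝ) ^ (-(1 / 2 + (s - 1) / 2))) ^ 2 = (q : ℝ) ^ (-s) := by
    rw [← Real.rpow_mul_natCast (Nat.cast_nonneg _)]
    congr 1
    push_cast
    ring
  refine ⟨(s - 1) / 2, half_pos hs0, F, fun q hq => hF q hq _ (by linarith), ?_⟩
  simp_rw [sq_eq]
  refine ⟨Real.exp_le_exp.1 (hM.trans hcF), ?_⟩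
  rw [div_le_iff₀ hs0] at hcF
  linarith

lemma eventually_lt_const_mul_exp {c a : ℝ} (hc : 0 < c) (ha : 0 < a) (C : ℝ) :
    ∀ᶠ S in atTop, C < c * Real.exp (a * S) :=
  ((Real.tendsto_exp_atTop.comp (tendsto_id.const_mul_atTop ha)).const_mul_atTop
    hc).eventually_gt_atTop C

lemma eventually_exp_add_mul_le {a b : ℝ} (ha : 0 < a) (hb : 0 < b) :
    ∀ᶠ S in atTop,
      Real.exp ((a + b) * S) ≤ 4 * ((Real.exp (a * S) - 1) * (Real.exp (b * S) - 1)) := by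
  filter_upwards [eventually_lt_const_mul_exp one_pos ha 2,
    eventually_lt_const_mul_exp one_pos hb 2] with S hA hB
  rw [add_mul, Real.exp_add]
  nlinarith

lemma prod_exp_mul {ι : Type*} [Fintype ι] (c : ℝ) (a : ι → ℝ) :
    ∏ i, Real.exp (c * a i) = Real.exp (c * ∑ i, a i) := by
  rw [← Real.exp_sum, Finset.mul_sum]

section

variable {ι : Type*} [Fintype ι] [DecidableEq ι] (q : ι ↪ Nat.Primes)

/-- The Dirichlet polynomial `∏ᵢ (1 + (2/p) qᵢ^{-σ} qᵢ^{-s})`, on which the transform is tested. -/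
def testPoly (p σ : ℝ) : ℕ+ →₀ ℂ :=
  eulerPoly q 1 fun i k => (testCoeff p ((q i : ℝ) ^ (-σ)) k : ℂ)

/-- The part with nonnegative exponents of the dual trigonometric polynomial `∏ᵢ ∑ₖ cₖ qᵢ^{ikt}`,
with `cₖ = dualCoeff p (qᵢ^{-σ}) k`. -/
def dualPoly (p σ : ℝ) : ℕ+ →₀ ℂ :=
  eulerPoly q 2 fun i k => (dualCoeff p ((q i : ℝ) ^ (-σ)) k : ℂ)

variable {q} {p ε σ : ℝ}

lemma dirNorm_testPoly_le (hp : 0 < p) (h : ∀ i, FactorEstimates p ε ((q i : ℝ) ^ (-σ))) :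
    dirNorm p (testPoly q p σ) ≤ Real.exp ((1 + ε) / p * ∑ i, ((q i : ℝ) ^ (-σ)) ^ 2) := by
  have hnorm := dirNorm_eulerPoly_le q hp fun i => (h i).cosMajorized_test
  rw [prod_exp_mul, ← Real.exp_mul] at hnorm
  exact hnorm.trans_eq (congrArg Real.exp (by ring))

lemma norm_sum_dualPoly_mul_coeff_le [hp : Fact (1 ≤ p)]
    (h : ∀ i, FactorEstimates p ε ((q i : ℝ) ^ (-σ))) (F : DirHardy p) :
    ‖(dualPoly q p σ).sum fun n b => b * DirHardy.coeff n F‖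
      ≤ Real.exp ((ε + (p / 4 + ε) * (1 - 1 / p)) * ∑ i, ((q i : ℝ) ^ (-σ)) ^ 2) * ‖F‖ := by
  have hdual := norm_sum_eulerPoly_mul_coeff_le q (fun i => (h i).dualMajorant_nonneg)
    (fun i => (h i).cosMajorized_dualMajorant) (fun i => (Real.exp_pos _).le)
    (fun i => (h i).norm_sum_dualCoeff_le) F
  rw [prod_exp_mul, prod_exp_mul, ← Real.exp_mul, ← Real.exp_add] at hdual
  exact hdual.trans_eq (congrArg (Real.exp · * ‖F‖) (by ring))

lemma exp_sub_one_le_norm_dirEval_testPoly (hp : 0 ≤ p)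
    (h : ∀ i, FactorEstimates p ε ((q i : ℝ) ^ (-σ))) :
    Real.exp ((2 / p - ε) * ∑ i, ((q i : ℝ) ^ (-σ)) ^ 2) - 1
      ≤ ‖dirEval ((testPoly q p σ).erase 1) σ‖ := by
  have hx (i : ι) : 0 ≤ (q i : ℝ) ^ (-σ) := by positivity
  have hvalue := prod_sum_sub_one_le_norm_dirEval_erase q 1
    (c := fun i => testCoeff p ((q i : ℝ) ^ (-σ))) (fun i => testCoeff_nonneg hp (hx i) 0)
    (fun i => (pow_zero _).le) σ
  refine le_trans ?_ hvalue
  rw [← prod_exp_mul]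
  exact sub_le_sub_right (Finset.prod_le_prod (fun i _ => (Real.exp_pos _).le)
    fun i _ => (h i).exp_le_test) 1

lemma exp_sub_one_le_norm_dirEval_dualPoly (hp : 0 ≤ p)
    (h : ∀ i, FactorEstimates p ε ((q i : ℝ) ^ (-σ))) :
    Real.exp ((p / 2 - 1 / 4 - ε) * ∑ i, ((q i : ℝ) ^ (-σ)) ^ 2) - 1
      ≤ ‖dirEval ((dualPoly q p σ).erase 1) σ‖ := by
  have hx (i : ι) : 0 ≤ (q i : ℝ) ^ (-σ) := by positivity
  have hvalue := prod_sum_sub_one_le_norm_dirEval_erase q 2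
    (c := fun i k => dualCoeff p ((q i : ℝ) ^ (-σ)) k)
    (fun i => dualCoeff_natCast_nonneg hp (hx i) (h i).le_one 0)
    (fun i => (dualCoeff_zero _ _).trans_le (sub_le_self 1 (by positivity))) σ
  refine le_trans ?_ hvalue
  rw [← prod_exp_mul]
  exact sub_le_sub_right (Finset.prod_le_prod (fun i _ => (Real.exp_pos _).le)
    fun i _ => (h i).exp_le_dual) 1

open scoped ComplexOrder in
lemma testPoly_nonneg (hp : 0 ≤ p) (n : ℕ+) : 0 ≤ testPoly q p σ n :=
  eulerPoly_nonneg q 1 (fun _ k => Complex.zero_le_real.2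
    (testCoeff_nonneg hp (Real.rpow_nonneg (Nat.cast_nonneg _) _) k)) n

open scoped ComplexOrder in
lemma dualPoly_nonneg (hp : 0 ≤ p) (h : ∀ i, FactorEstimates p ε ((q i : ℝ) ^ (-σ))) (n : ℕ+) :
    0 ≤ dualPoly q p σ n :=
  eulerPoly_nonneg q 2 (fun i k => Complex.zero_le_real.2 (dualCoeff_natCast_nonneg hp
    (Real.rpow_nonneg (Nat.cast_nonneg _) _) (h i).le_one k)) n

end

lemma ExtendsMulHilbert.mul_exp_sub_one_mul_le {ι : Type*} [Fintype ι] {q : ι ↪ Nat.Primes}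
    {p ε : ℝ} [hp : Fact (1 ≤ p)]
    {T : DirHardyZero p →L[ℂ] DirHardyZero p} (hT : ExtendsMulHilbert T)
    (hε : ε ≤ p / 2 - 1 / 4) {δ : ℝ} (hδ : 0 ≤ δ)
    (h : ∀ i, FactorEstimates p ε ((q i : ℝ) ^ (-(1 / 2 + δ)))) {S : ℝ}
    (hS : S = ∑ i, ((q i : ℝ) ^ (-(1 / 2 + δ))) ^ 2) :
    δ * ((Real.exp ((2 / p - ε) * S) - 1) * (Real.exp ((p / 2 - 1 / 4 - ε) * S) - 1))
      ≤ 2 * ‖T‖ * Real.exp ((p / 4 - 1 / 4 + 1 / p + 2 * ε) * S) := by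
  classical
  have hp0 : 0 < p := zero_lt_one.trans_le hp.out
  have hS0 : 0 ≤ S := hS ▸ Finset.sum_nonneg fun i _ => sq_nonneg _
  have hbilinear := hT.mul_norm_dirEval_mul_le (A := testPoly q p (1 / 2 + δ))
    (testPoly_nonneg hp0.le) (dualPoly_nonneg hp0.le h) (Real.exp_pos _).le
    (norm_sum_dualPoly_mul_coeff_le h) hδ
  have htest := exp_sub_one_le_norm_dirEval_testPoly hp0.le h
  have hdual := exp_sub_one_le_norm_dirEval_dualPoly hp0.le h
  have hnorm := dirNorm_testPoly_le hp0 h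
  rw [← hS] at hbilinear htest hdual hnorm
  calc
    _ ≤ δ * (‖dirEval ((testPoly q p (1 / 2 + δ)).erase 1) (1 / 2 + δ : ℝ)‖
        * ‖dirEval ((dualPoly q p (1 / 2 + δ)).erase 1) (1 / 2 + δ : ℝ)‖) := by
      gcongr
      exact sub_nonneg.2 (Real.one_le_exp (mul_nonneg (sub_nonneg.2 hε) hS0))
    _ ≤ _ := hbilinear
    _ ≤ Real.exp ((ε + (p / 4 + ε) * (1 - 1 / p)) * S)
        * (‖T‖ * (2 * Real.exp ((1 + ε) / p * S))) := by gcongr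
    _ = 2 * ‖T‖ * Real.exp ((p / 4 - 1 / 4 + 1 / p + 2 * ε) * S) := by
      rw [show (p / 4 - 1 / 4 + 1 / p + 2 * ε) * S
          = (ε + (p / 4 + ε) * (1 - 1 / p)) * S + (1 + ε) / p * S by field_simp; ring,
        Real.exp_add]
      ring

lemma exists_pos_lt_exponent_gap {p : ℝ} (hp : 1 ≤ p) (hp2 : p ≠ 2) :
    ∃ ε > 0, ε < 2 / p ∧ ε < p / 2 - 1 / 4 ∧ 4 * ε < 1 / p + p / 4 - 1 := by
  have hp0 : 0 < p := by linarith
  have gap_pos : 0 < 1 / p + p / 4 - 1 := by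
    have := sq_pos_of_ne_zero (sub_ne_zero.2 hp2)
    calc
      0 < (p - 2) ^ 2 / (4 * p) := by positivity
      _ = 1 / p + p / 4 - 1 := by field_simp; ring
  obtain ⟨ε, hε, hlt⟩ := exists_between
    (lt_min (a := 0) (div_pos two_pos hp0) (lt_min (b := p / 2 - 1 / 4) (by linarith)
      (div_pos gap_pos four_pos)))
  simp only [lt_min_iff] at hlt
  exact ⟨ε, hε, hlt.1, hlt.2.1, by linarith [hlt.2.2]⟩

end

theorem theorem5 (p : ℝ) [Fact (1 ≤ p)] (hp2 : p ≠ 2) :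
    ¬ ∃ T : DirHardyZero p →L[ℂ] DirHardyZero p,
      ∀ (P : DirPoly p) (hP : (P : DirHardy p) ∈ DirHardyZero p) (s : ℂ), 1 / 2 < s.re →
        DirHardy.toFun (T ⟨(P : DirHardy p), hP⟩ : DirHardy p) s = mulHilbert P.eval s := by
  rintro ⟨T, hT⟩
  have hp : 1 ≤ p := Fact.out
  obtain ⟨ε, hε, hε_test, hε_dual, hε_gap⟩ := exists_pos_lt_exponent_gap hp hp2
  obtain ⟨c, hc, hprimes⟩ := exists_primes_factorEstimates hp hε
  obtain ⟨M, hM⟩ := eventually_atTop.1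
    ((eventually_exp_add_mul_le (sub_pos.2 hε_test) (sub_pos.2 hε_dual)).and
      (eventually_lt_const_mul_exp hc (sub_pos.2 hε_gap) (8 * ‖T‖)))
  obtain ⟨δ, hδ, F, hF, hMS, hcS⟩ := hprimes M
  obtain ⟨hexp, hlarge⟩ := hM _ hMS
  have hupper := ExtendsMulHilbert.mul_exp_sub_one_mul_le (q := .subtype (· ∈ F)) hT
    hε_dual.le hδ.le (fun i => hF i i.2)
    (Finset.sum_coe_sort F fun q => ((q : ℝ) ^ (-(1 / 2 + δ))) ^ 2).symm
  generalize ∑ q ∈ F, ((q : ℝ) ^ (-(1 / 2 + δ))) ^ 2 = S at *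
  refine hlarge.not_ge (le_of_mul_le_mul_right ?_
    (Real.exp_pos ((p / 4 - 1 / 4 + 1 / p + 2 * ε) * S)))
  calc
    _ ≤ δ * Real.exp S * Real.exp ((1 / p + p / 4 - 1 - 4 * ε) * S)
        * Real.exp ((p / 4 - 1 / 4 + 1 / p + 2 * ε) * S) := by gcongr
    _ = δ * Real.exp ((2 / p - ε + (p / 2 - 1 / 4 - ε)) * S) := by
      rw [mul_assoc, mul_assoc, ← Real.exp_add, ← Real.exp_add]
      ring_nf
    _ ≤ 8 * ‖T‖ * Real.exp ((p / 4 - 1 / 4 + 1 / p + 2 * ε) * S) := by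
      linarith [mul_le_mul_of_nonneg_left hexp hδ.le]
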